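/- **Setting.** $H^2(\mathbb D;E)$ is the Hilbert space of analytic functions on $\mathbb D$, with values in the Hilbert space $E$, whose Taylor coefficients are square-summable (with the $\ell^2$ inner product of the coefficients); $H^2=H^2(\mathbb D)=H^2(\mathbb D;\mathbb C)$, and $H^2(\mathbb D^2)$ is defined likewise on the bidisc. A function $\Psi\in H^\infty(\mathbb D;\mathcal B(E,F))$ (bounded analytic, operator-valued) is *inner* if multiplication by $\Psi$ is an isometry $H^2(\mathbb D;E)\to H^2(\mathbb D;F)$; a scalar inner function $\varphi\in H^\infty(\mathbb D)$ is the case $E=F=\mathbb C$, and $K_\varphi:=H^2\ominus\varphi H^2$. For a one-variable function $f$ put $f_{z_2}(z_1,z_2):=f(z_2)$, and let $H^2_{z_1}$ be the set of functions $(z_1,z_2)\mapsto h(z_1)$ with $h\in H^2$. For $\Psi\in H^\infty(\mathbb D;\mathcal B(\mathcal E,K_\varphi))$, the space $\Psi H^2(\mathbb D;\mathcal E)\subseteq H^2(\mathbb D;K_\varphi)$ is regarded as a subspace of $H^2(\mathbb D^2)\cong H^2(\mathbb D;H^2)$ (with respect to the variable $z_1$): it consists of the functions $(z_1,z_2)\mapsto(\Psi(z_1)h(z_1))(z_2)$,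 $h\in H^2(\mathbb D;\mathcal E)$. Let $\sigma>0$ and $\theta\in[0,2\pi)$. The Brownian shift on $H^2\oplus\mathbb C$ and the $3$-Brownian shift on $H^2(\mathbb D^2)\oplus H^2\oplus\mathbb C$ are $$B_{\sigma,\theta}(f,\alpha)=(zf+\sigma\alpha,\ e^{i\theta}\alpha),\qquad T_{\sigma,\theta}(F,f,\alpha)=(z_1F+\sigma f_{z_2},\ zf+\sigma\alpha,\ e^{i\theta}\alpha).$$ Invariant subspaces are closed, and $\oplus$ denotes orthogonal direct sums. **Theorem.** Let $\mathcal M=\mathcal M_0\oplus\mathcal M_1$, with $\mathcal M_0\subseteq H^2(\mathbb D^2)$ and $\mathcal M_1\subseteq H^2\oplus\mathbb C$, be an invariant subspace of $T_{\sigma,\theta}$, where $\mathcal M_1$ is a nonzero invariant subspace of $B_{\sigma,\theta}$. Then $\mathcal M_1$ has the form in (1) or the form in (2) below, and: 1. If $\mathcal M_1=\varphi H^2\oplus\{0\}$ for an inner function $\varphi\in H^\infty(\mathbb D)$ (Type I), then there are a Hilbert space $\mathcal E$ and an operator-valued inner function $\Psi\in H^\infty(\mathbb D;\mathcal B(\mathcal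 E,K_\varphi))$ such that $$\mathcal M_0=\varphi_{z_2}H^2(\mathbb D^2)\oplus\Psi H^2(\mathbb D;\mathcal E).$$ 2. If $\mathcal M_1=\mathbb C\begin{bmatrix}g\\1\end{bmatrix}\oplus(\varphi H^2\oplus\{0\})$, where $\varphi\in H^\infty(\mathbb D)$ is an inner function whose radial limit $\varphi(e^{i\theta})$ exists and $g\in H^2$ is given by $$g(z)=\sigma\,\frac{\overline{\varphi(e^{i\theta})}\,\varphi(z)-1}{z-e^{i\theta}},\qquad z\in\mathbb D$$ (Type II), then $g\in K_\varphi$, and there are a Hilbert space $\mathcal E$ and an operator-valued inner function $\Psi\in H^\infty(\mathbb D;\mathcal B(\mathcal E,K_\varphi))$ such that $$\mathcal M_0=\varphi_{z_2}H^2(\mathbb D^2)\oplus g_{z_2}H^2_{z_1}\oplus\Psi H^2(\mathbb D;\mathcal E),\qquad \Psi(0)\mathcal E\subseteq g^\perp\subseteq K_\varphi .$$ -/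

import Mathlib

open scoped Topology ComplexConjugate

noncomputable section

/-- The open unit disc `𝔻`. -/
abbrev unitDisc : Set ℂ := Metric.ball (0 : ℂ) 1

/-- The Hardy space `H²(𝔻; E)`: the function `∑ aₙ zⁿ` is represented by its square-summable
sequence of Taylor coefficients, with the `ℓ²` inner product. -/
abbrev Hardy (E : Type*) [NormedAddCommGroup E] : Type _ := lp (fun _ : ℕ => E) 2

/-- The Hardy space `H²(𝔻²)` of the bidisc: the function `∑ aₘₙ z₁ᵐ z₂ⁿ` is represented by its
square-summable double sequence of Taylor coefficients, with the `ℓ²` inner product. -/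
abbrev HardyBidisc : Type := lp (fun _ : ℕ × ℕ => ℂ) 2

/-- The value at `z` of the function in `H²(𝔻; E)` with Taylor coefficients `f`. -/
def hardyEval {E : Type*} [NormedAddCommGroup E] [NormedSpace ℂ E] (f : Hardy E) (z : ℂ) : E :=
  ∑' n : ℕ, z ^ n • f n

/-- The value at `(z₁, z₂)` of the function in `H²(𝔻²)` with Taylor coefficients `F`. -/
def bidiscEval (F : HardyBidisc) (z₁ z₂ : ℂ) : ℂ :=
  ∑' p : ℕ × ℕ, z₁ ^ p.1 * z₂ ^ p.2 * F p

section Evaluation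

theorem hardyEval_summable {E : Type*} [NormedAddCommGroup E] [NormedSpace ℂ E] [CompleteSpace E]
    (f : Hardy E) {z : ℂ} (hz : z ∈ unitDisc) : Summable (fun n : ℕ => z ^ n • f n) := by
  have hz' : ‖z‖ < 1 := by simpa using hz
  refine Summable.of_norm_bounded (g := fun n : ℕ => ‖z‖ ^ n * ‖f‖)
    ((summable_geometric_of_lt_one (norm_nonneg _) hz').mul_right _) fun n => ?_
  rw [norm_smul, norm_pow]
  exact mul_le_mul_of_nonneg_left (lp.norm_apply_le_norm (by norm_num) f n) (by positivity)

theorem bidiscEval_summable (F : HardyBidisc) {z₁ z₂ : ℂ} (h₁ : z₁ ∈ unitDisc)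
    (h₂ : z₂ ∈ unitDisc) : Summable (fun p : ℕ × ℕ => z₁ ^ p.1 * z₂ ^ p.2 * F p) := by
  have h₁' : ‖z₁‖ < 1 := by simpa using h₁
  have h₂' : ‖z₂‖ < 1 := by simpa using h₂
  have hs := (summable_geometric_of_lt_one (norm_nonneg _) h₁').mul_of_nonneg
    (summable_geometric_of_lt_one (norm_nonneg _) h₂')
    (fun n => by positivity) (fun n => by positivity)
  refine Summable.of_norm_bounded (hs.mul_right ‖F‖) fun p => ?_
  rw [norm_mul, norm_mul, norm_pow, norm_pow]
  exact mul_le_mul_of_nonneg_left (lp.norm_apply_le_norm (by norm_num) F p) (by positivity)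

theorem hardyEval_zero {E : Type*} [NormedAddCommGroup E] [NormedSpace ℂ E] (z : ℂ) :
    hardyEval (0 : Hardy E) z = 0 := by
  simp [hardyEval]

theorem hardyEval_add {E : Type*} [NormedAddCommGroup E] [NormedSpace ℂ E] [CompleteSpace E]
    (f g : Hardy E) {z : ℂ} (hz : z ∈ unitDisc) :
    hardyEval (f + g) z = hardyEval f z + hardyEval g z := by
  simp only [hardyEval, lp.coeFn_add, Pi.add_apply, smul_add]
  exact (hardyEval_summable f hz).tsum_add (hardyEval_summable g hz)

theorem hardyEval_smul {E : Type*} [NormedAddCommGroup E] [NormedSpace ℂ E] [CompleteSpace E]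
    (c : ℂ) (f : Hardy E) {z : ℂ} (hz : z ∈ unitDisc) :
    hardyEval (c • f) z = c • hardyEval f z := by
  simp only [hardyEval, lp.coeFn_smul, Pi.smul_apply]
  rw [← (hardyEval_summable f hz).tsum_const_smul]
  exact tsum_congr fun n => smul_comm _ _ _

theorem bidiscEval_zero (z₁ z₂ : ℂ) : bidiscEval 0 z₁ z₂ = 0 := by
  simp [bidiscEval]

theorem bidiscEval_add (F G : HardyBidisc) {z₁ z₂ : ℂ} (h₁ : z₁ ∈ unitDisc) (h₂ : z₂ ∈ unitDisc) :
    bidiscEval (F + G) z₁ z₂ = bidiscEval F z₁ z₂ + bidiscEval G z₁ z₂ := by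
  simp only [bidiscEval, lp.coeFn_add, Pi.add_apply, mul_add]
  exact (bidiscEval_summable F h₁ h₂).tsum_add (bidiscEval_summable G h₁ h₂)

theorem bidiscEval_smul (c : ℂ) (F : HardyBidisc) (z₁ z₂ : ℂ) :
    bidiscEval (c • F) z₁ z₂ = c * bidiscEval F z₁ z₂ := by
  simp only [bidiscEval, lp.coeFn_smul, Pi.smul_apply, smul_eq_mul]
  rw [← tsum_mul_left]
  exact tsum_congr fun p => by ring

end Evaluation

/-! ### The Brownian shift and the 3-Brownian shift -/

/-- For an injective map `e` of index sets, the isometry of `ℓ²(ι; E)` into `ℓ²(κ; E)` that moves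
the `i`-th coefficient to the place `e i` and fills the other places with zeros. -/
def coeffPush {ι κ E : Type*} [NormedAddCommGroup E] [NormedSpace ℂ E] (e : ι → κ)
    (he : Function.Injective e) :
    lp (fun _ : ι => E) 2 →ₗᵢ[ℂ] lp (fun _ : κ => E) 2 where
  toFun f := ⟨Function.extend e f 0, by
    have h2 : (0 : ℝ) < (2 : ENNReal).toReal := by norm_num
    refine memℓp_gen ?_
    have h := (memℓp_gen_iff h2).1 (lp.memℓp f)
    rw [← summable_extend_zero he] at h
    refine h.congr fun k => ?_
    by_cases hk : ∃ i, e i = k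
    · obtain ⟨i, rfl⟩ := hk
      simp [he.extend_apply]
    · simp [Function.extend_apply' _ _ _ hk]⟩
  map_add' f g := by
    ext k
    change Function.extend e (⇑f + ⇑g) 0 k
      = Function.extend e (⇑f) 0 k + Function.extend e (⇑g) 0 k
    by_cases hk : ∃ i, e i = k
    · obtain ⟨i, rfl⟩ := hk
      simp [he.extend_apply]
    · simp [Function.extend_apply' _ _ _ hk]
  map_smul' c f := by
    ext k
    by_cases hk : ∃ i, e i = k
    · obtain ⟨i, rfl⟩ := hk
      simp [he.extend_apply]
    · simp [Function.extend_apply' _ _ _ hk]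
  norm_map' f := by
    have h2 : (0 : ℝ) < (2 : ENNReal).toReal := by norm_num
    rw [lp.norm_eq_tsum_rpow h2, lp.norm_eq_tsum_rpow h2, ← tsum_extend_zero he]
    congr 1
    refine tsum_congr fun k => ?_
    by_cases hk : ∃ i, e i = k
    · obtain ⟨i, rfl⟩ := hk
      simp [he.extend_apply]
    · simp [Function.extend_apply' _ _ _ hk]

/-- The unilateral shift `S` on `H²(𝔻)`, `(S f)(z) = z f(z)`. -/
def shiftS : Hardy ℂ →L[ℂ] Hardy ℂ :=
  (coeffPush Nat.succ Nat.succ_injective).toContinuousLinearMap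

/-- Multiplication by the first variable on `H²(𝔻²)`, `(M F)(z₁, z₂) = z₁ F(z₁, z₂)`. -/
def mulZ₁ : HardyBidisc →L[ℂ] HardyBidisc :=
  (coeffPush (fun p : ℕ × ℕ => (p.1 + 1, p.2)) (by
    rintro ⟨a, b⟩ ⟨c, d⟩ h; simpa using h)).toContinuousLinearMap

/-- The canonical embedding `J : H²(𝔻) → H²(𝔻²)`, `(J f)(z₁, z₂) = f(z₂)`. -/
def embedJ : Hardy ℂ →L[ℂ] HardyBidisc :=
  (coeffPush (fun n : ℕ => ((0 : ℕ), n)) (by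
    intro a b h; simpa using h)).toContinuousLinearMap

/-- The operator `1 ⊗ 1 : ℂ → H²(𝔻)` that sends a scalar to the constant function. -/
def constEmbed : ℂ →L[ℂ] Hardy ℂ := lp.singleContinuousLinearMap ℂ (fun _ : ℕ => ℂ) 2 0

section OperatorFormulas

theorem coeffPush_tsum {ι κ : Type*} (e : ι → κ) (he : Function.Injective e)
    (f : lp (fun _ : ι => ℂ) 2) (w : κ → ℂ) :
    ∑' k, w k * coeffPush e he f k = ∑' i, w (e i) * f i := by
  rw [← tsum_extend_zero he]
  refine tsum_congr fun k => ?_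
  change w k * Function.extend e f 0 k = _
  by_cases hk : ∃ i, e i = k
  · obtain ⟨i, rfl⟩ := hk
    simp [he.extend_apply]
  · simp [Function.extend_apply' _ _ _ hk]

theorem hardyEval_shiftS (f : Hardy ℂ) (z : ℂ) :
    hardyEval (shiftS f) z = z * hardyEval f z := by
  have h := coeffPush_tsum Nat.succ Nat.succ_injective f (fun n => z ^ n)
  simp only [hardyEval, smul_eq_mul]
  rw [← tsum_mul_left]
  exact h.trans (tsum_congr fun n => by rw [Nat.succ_eq_add_one]; ring)

theorem bidiscEval_mulZ₁ (F : HardyBidisc) (z₁ z₂ : ℂ) :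
    bidiscEval (mulZ₁ F) z₁ z₂ = z₁ * bidiscEval F z₁ z₂ := by
  have h := coeffPush_tsum (fun p : ℕ × ℕ => (p.1 + 1, p.2))
    (by rintro ⟨a, b⟩ ⟨c, d⟩ h; simpa using h) F (fun p => z₁ ^ p.1 * z₂ ^ p.2)
  simp only [bidiscEval]
  rw [← tsum_mul_left]
  exact h.trans (tsum_congr fun n => by ring)

theorem bidiscEval_embedJ (f : Hardy ℂ) (z₁ z₂ : ℂ) :
    bidiscEval (embedJ f) z₁ z₂ = hardyEval f z₂ := by
  have h := coeffPush_tsum (fun n : ℕ => ((0 : ℕ), n))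
    (by intro a b h; simpa using h) f (fun p => z₁ ^ p.1 * z₂ ^ p.2)
  simp only [bidiscEval, hardyEval, smul_eq_mul]
  exact h.trans (tsum_congr fun n => by simp)

theorem hardyEval_constEmbed (α z : ℂ) : hardyEval (constEmbed α) z = α := by
  simp only [hardyEval, smul_eq_mul]
  rw [tsum_eq_single 0]
  · simp [constEmbed]
  · intro n hn
    simp [constEmbed, hn]

end OperatorFormulas

/-- The Hilbert space `H²(𝔻) ⊕ ℂ`. -/
abbrev BrownianSpace : Type := WithLp 2 (Hardy ℂ × ℂ)

/-- The Hilbert space `H²(𝔻²) ⊕ (H²(𝔻) ⊕ ℂ)`. -/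
abbrev ThreeBrownianSpace : Type := WithLp 2 (HardyBidisc × BrownianSpace)

/-- The Brownian shift `(f, α) ↦ (S f + σ (1 ⊗ 1) α, e^{iθ} α)`. -/
def brownianShift (σ θ : ℝ) : BrownianSpace →L[ℂ] BrownianSpace :=
  (WithLp.prodContinuousLinearEquiv 2 ℂ (Hardy ℂ) ℂ).symm.toContinuousLinearMap ∘L
    ((shiftS ∘L WithLp.fstL 2 ℂ (Hardy ℂ) ℂ
        + (σ : ℂ) • (constEmbed ∘L WithLp.sndL 2 ℂ (Hardy ℂ) ℂ)).prod
      (Complex.exp (θ * Complex.I) • WithLp.sndL 2 ℂ (Hardy ℂ) ℂ))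

/-- The 3-Brownian shift
`(F, f, α) ↦ (z₁ F + σ J f, S f + σ (1 ⊗ 1) α, e^{iθ} α)`. -/
def threeBrownianShift (σ θ : ℝ) : ThreeBrownianSpace →L[ℂ] ThreeBrownianSpace :=
  (WithLp.prodContinuousLinearEquiv 2 ℂ HardyBidisc BrownianSpace).symm.toContinuousLinearMap ∘L
    ((mulZ₁ ∘L WithLp.fstL 2 ℂ HardyBidisc BrownianSpace
        + (σ : ℂ) • (embedJ ∘L WithLp.fstL 2 ℂ (Hardy ℂ) ℂ ∘L
            WithLp.sndL 2 ℂ HardyBidisc BrownianSpace)).prod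
      (brownianShift σ θ ∘L WithLp.sndL 2 ℂ HardyBidisc BrownianSpace))

theorem brownianShift_apply (σ θ : ℝ) (f : Hardy ℂ) (α : ℂ) :
    brownianShift σ θ (WithLp.toLp 2 (f, α)) =
      WithLp.toLp 2 (shiftS f + (σ : ℂ) • constEmbed α, Complex.exp (θ * Complex.I) * α) := rfl

theorem threeBrownianShift_apply (σ θ : ℝ) (F : HardyBidisc) (f : Hardy ℂ) (α : ℂ) :
    threeBrownianShift σ θ (WithLp.toLp 2 (F, WithLp.toLp 2 (f, α))) =
      WithLp.toLp 2 (mulZ₁ F + (σ : ℂ) • embedJ f,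
        WithLp.toLp 2 (shiftS f + (σ : ℂ) • constEmbed α,
          Complex.exp (θ * Complex.I) * α)) := rfl

/-- An invariant subspace of an operator is a closed subspace that the operator maps into
itself. -/
def IsInvariantSubspace {H : Type*} [NormedAddCommGroup H] [NormedSpace ℂ H] (T : H →L[ℂ] H)
    (M : Submodule ℂ H) : Prop :=
  IsClosed (M : Set H) ∧ ∀ x ∈ M, T x ∈ M

/-- The subspace `A ⊕ B = {(x, y) : x ∈ A, y ∈ B}` of the Hilbert space direct sum `H ⊕ K`. -/
def hilbertProd {H K : Type*} [NormedAddCommGroup H] [NormedSpace ℂ H] [NormedAddCommGroup K]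
    [NormedSpace ℂ K] (A : Submodule ℂ H) (B : Submodule ℂ K) : Submodule ℂ (WithLp 2 (H × K)) :=
  (A.prod B).comap (WithLp.linearEquiv 2 ℂ (H × K)).toLinearMap

/-! ### Inner functions and the subspaces they generate -/

/-- `Ψ` is an inner function: it belongs to `H^∞(𝔻; B(E, F))` and the multiplication operator
`M_Ψ : H²(𝔻; E) → H²(𝔻; F)` is an isometry. Only the values of `Ψ` on `𝔻` matter. -/
structure IsInnerFunction {E F : Type*} [NormedAddCommGroup E] [NormedSpace ℂ E]
    [NormedAddCommGroup F] [NormedSpace ℂ F] (Ψ : ℂ → E →L[ℂ] F) : Prop where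
  analytic : DifferentiableOn ℂ Ψ unitDisc
  bounded : ∃ C : ℝ, ∀ z ∈ unitDisc, ‖Ψ z‖ ≤ C
  isometry : ∀ f : Hardy E, ∃ g : Hardy F,
    (∀ z ∈ unitDisc, hardyEval g z = Ψ z (hardyEval f z)) ∧ ‖g‖ = ‖f‖

/-- A scalar inner function: the case `E = F = ℂ`, where `φ(z)` acts by multiplication. -/
def IsScalarInner (φ : ℂ → ℂ) : Prop :=
  IsInnerFunction (fun z => φ z • ContinuousLinearMap.id ℂ ℂ)

/-- The subspace `φ H²(𝔻)` of `H²(𝔻)`. -/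
def mulHardy (φ : ℂ → ℂ) : Submodule ℂ (Hardy ℂ) where
  carrier := {f | ∃ h : Hardy ℂ, ∀ z ∈ unitDisc, hardyEval f z = φ z * hardyEval h z}
  add_mem' := by
    rintro f₁ f₂ ⟨h₁, H₁⟩ ⟨h₂, H₂⟩
    refine ⟨h₁ + h₂, fun z hz => ?_⟩
    rw [hardyEval_add _ _ hz, hardyEval_add _ _ hz, H₁ z hz, H₂ z hz]
    ring
  zero_mem' := ⟨0, fun z _ => by simp [hardyEval_zero]⟩
  smul_mem' := by
    rintro c f ⟨h, H⟩
    refine ⟨c • h, fun z hz => ?_⟩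
    rw [hardyEval_smul _ _ hz, hardyEval_smul _ _ hz, H z hz]
    simp only [smul_eq_mul]
    ring

/-- The model space `K_φ = H²(𝔻) ⊖ φ H²(𝔻)`. -/
abbrev modelSpace (φ : ℂ → ℂ) : Submodule ℂ (Hardy ℂ) := (mulHardy φ)ᗮ

/-- The subspace `φ_{z₂} H²(𝔻²)` of `H²(𝔻²)`, where `φ_{z₂}(z₁, z₂) = φ(z₂)`. -/
def mulBidisc (φ : ℂ → ℂ) : Submodule ℂ HardyBidisc where
  carrier := {F | ∃ G : HardyBidisc, ∀ z₁ ∈ unitDisc, ∀ z₂ ∈ unitDisc,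
    bidiscEval F z₁ z₂ = φ z₂ * bidiscEval G z₁ z₂}
  add_mem' := by
    rintro f₁ f₂ ⟨h₁, H₁⟩ ⟨h₂, H₂⟩
    refine ⟨h₁ + h₂, fun z hz w hw => ?_⟩
    rw [bidiscEval_add _ _ hz hw, bidiscEval_add _ _ hz hw, H₁ z hz w hw, H₂ z hz w hw]
    ring
  zero_mem' := ⟨0, fun z _ w _ => by simp [bidiscEval_zero]⟩
  smul_mem' := by
    rintro c f ⟨h, H⟩
    refine ⟨c • h, fun z hz w hw => ?_⟩
    rw [bidiscEval_smul, bidiscEval_smul, H z hz w hw]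
    ring

/-- The subspace `g_{z₂} H²_{z₁}(𝔻)` of `H²(𝔻²)`: the functions `(z₁, z₂) ↦ g(z₂) h(z₁)` with
`h ∈ H²(𝔻)`. -/
def mulHardyZ₁ (g : Hardy ℂ) : Submodule ℂ HardyBidisc where
  carrier := {F | ∃ h : Hardy ℂ, ∀ z₁ ∈ unitDisc, ∀ z₂ ∈ unitDisc,
    bidiscEval F z₁ z₂ = hardyEval g z₂ * hardyEval h z₁}
  add_mem' := by
    rintro f₁ f₂ ⟨h₁, H₁⟩ ⟨h₂, H₂⟩
    refine ⟨h₁ + h₂, fun z hz w hw => ?_⟩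
    rw [bidiscEval_add _ _ hz hw, hardyEval_add _ _ hz, H₁ z hz w hw, H₂ z hz w hw]
    ring
  zero_mem' := ⟨0, fun z _ w _ => by simp [bidiscEval_zero, hardyEval_zero]⟩
  smul_mem' := by
    rintro c f ⟨h, H⟩
    refine ⟨c • h, fun z hz w hw => ?_⟩
    rw [bidiscEval_smul, hardyEval_smul _ _ hz, H z hz w hw]
    simp only [smul_eq_mul]
    ring

/-- The subspace `Ψ H²(𝔻; E)` of `H²(𝔻; K)`, for `K` a subspace of `H²(𝔻)`, seen inside
`H²(𝔻²)` by means of `H²(𝔻²) ≅ H²(𝔻; H²(𝔻))` with respect to the variable `z₁`: the functions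
`(z₁, z₂) ↦ (Ψ(z₁) h(z₁))(z₂)` with `h ∈ H²(𝔻; E)`. -/
def mulVector {E : Type*} [NormedAddCommGroup E] [NormedSpace ℂ E] [CompleteSpace E]
    {K : Submodule ℂ (Hardy ℂ)} (Ψ : ℂ → E →L[ℂ] K) : Submodule ℂ HardyBidisc where
  carrier := {F | ∃ h : Hardy E, ∀ z₁ ∈ unitDisc, ∀ z₂ ∈ unitDisc,
    bidiscEval F z₁ z₂ = hardyEval (Ψ z₁ (hardyEval h z₁) : Hardy ℂ) z₂}
  add_mem' := by
    rintro f₁ f₂ ⟨h₁, H₁⟩ ⟨h₂, H₂⟩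
    refine ⟨h₁ + h₂, fun z hz w hw => ?_⟩
    rw [bidiscEval_add _ _ hz hw, hardyEval_add _ _ hz, map_add, Submodule.coe_add,
      hardyEval_add _ _ hw, H₁ z hz w hw, H₂ z hz w hw]
  zero_mem' := ⟨0, fun z _ w _ => by simp [bidiscEval_zero, hardyEval_zero]⟩
  smul_mem' := by
    rintro c f ⟨h, H⟩
    refine ⟨c • h, fun z hz w hw => ?_⟩
    rw [bidiscEval_smul, hardyEval_smul _ _ hz, map_smul, Submodule.coe_smul,
      hardyEval_smul _ _ hw, H z hz w hw, smul_eq_mul]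

/-! ### Types of invariant subspaces of the Brownian shift -/

/-- The subspace `φ H²(𝔻) ⊕ {0}` of `H²(𝔻) ⊕ ℂ`. -/
def typeISubspace (φ : ℂ → ℂ) : Submodule ℂ BrownianSpace := hilbertProd (mulHardy φ) ⊥

/-- The subspace `ℂ (g, 1) ⊕ (φ H²(𝔻) ⊕ {0})` of `H²(𝔻) ⊕ ℂ`. -/
def typeIISubspace (φ : ℂ → ℂ) (g : Hardy ℂ) : Submodule ℂ BrownianSpace :=
  Submodule.span ℂ {WithLp.toLp 2 (g, (1 : ℂ))} ⊔ typeISubspace φ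

/-- The radial limit `φ(e^{iθ})` exists, and `g ∈ H²(𝔻)` is the function
`g(z) = σ (conj(φ(e^{iθ})) φ(z) - 1) / (z - e^{iθ})`. -/
def IsTypeIIPair (σ θ : ℝ) (φ : ℂ → ℂ) (g : Hardy ℂ) : Prop :=
  ∃ c : ℂ,
    Filter.Tendsto (fun r : ℝ => φ (r * Complex.exp (θ * Complex.I))) (𝓝[<] 1) (𝓝 c) ∧
    ∀ z ∈ unitDisc,
      hardyEval g z = σ * ((conj c * φ z - 1) / (z - Complex.exp (θ * Complex.I)))

end

/-!
Under `H²(𝔻²) ≅ H²(𝔻; H²)`, where `z₁` is the variable of the vector-valued space, `J f` is the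
constant function with value `f`. Applying the 3-Brownian shift to `(0, f, α)` therefore shows that
`𝓜₀` contains the constants with value in `A = {f : (f, α) ∈ 𝓜₁}`, hence all of `H²(𝔻; A)`. Here
`A` is `φ H²` in Type I and `φ H² ⊕ ℂ g` in Type II. What remains of `𝓜₀` is a `z₁`-invariant
subspace of `H²(𝔻; Aᗮ)`, to which the Beurling–Lax–Halmos theorem applies.

For the classification, `{f : (f, 0) ∈ 𝓜₁}` is shift-invariant, hence `{0}` or `φ H²` by Beurling's
theorem. If `𝓜₁` contains an element orthogonal to it with nonzero scalar part, normalised to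
`(g, 1)`, then `(B - e^{iθ})(g, 1) = (φ u, 0)`. Since `g ⟂ φ H²`, the function `φ u` is orthogonal
to `z φ H²`, so `u` is a constant, and its modulus is `σ` because `‖z g + σ‖² = ‖g‖² + σ²`; the
formula for `g` follows. Conversely, the `g` of that formula lies in `K_φ` because the backward
shift has no unimodular eigenvalue on `ℓ²`.
-/

noncomputable section

section PowerSeries

variable {X : Type*} [NormedAddCommGroup X] [NormedSpace ℂ X] [CompleteSpace X]

theorem hasFPowerSeriesOnBall_tsum_pow_smul {a : ℕ → X} {C : ℝ} (ha : ∀ n, ‖a n‖ ≤ C) :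
    HasFPowerSeriesOnBall (fun z : ℂ => ∑' n : ℕ, z ^ n • a n)
      (fun n => ContinuousMultilinearMap.mkPiRing ℂ (Fin n) (a n)) 0 1 := by
  set p : FormalMultilinearSeries ℂ ℂ X :=
    fun n => ContinuousMultilinearMap.mkPiRing ℂ (Fin n) (a n)
  have hp : 1 ≤ p.radius := by
    simpa using p.le_radius_of_bound C (r := 1) fun n => by simpa [p] using ha n
  have hsum : p.sum = fun z : ℂ => ∑' n : ℕ, z ^ n • a n := by
    funext z
    simp [p, FormalMultilinearSeries.sum]
  exact hsum ▸ (p.hasFPowerSeriesOnBall (one_pos.trans_le hp)).mono one_pos hp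

theorem differentiableOn_tsum_pow_smul {a : ℕ → X} {C : ℝ} (ha : ∀ n, ‖a n‖ ≤ C) :
    DifferentiableOn ℂ (fun z : ℂ => ∑' n : ℕ, z ^ n • a n) unitDisc := by
  have h := (hasFPowerSeriesOnBall_tsum_pow_smul ha).differentiableOn
  rwa [← ENNReal.ofReal_one, Metric.eball_ofReal] at h

theorem eq_of_tsum_pow_smul_eqOn {a b : ℕ → X} {C D : ℝ}
    (ha : ∀ n, ‖a n‖ ≤ C) (hb : ∀ n, ‖b n‖ ≤ D)
    (h : Set.EqOn (fun z : ℂ => ∑' n : ℕ, z ^ n • a n) (fun z => ∑' n : ℕ, z ^ n • b n)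
      unitDisc) : a = b := by
  have hab := (hasFPowerSeriesOnBall_tsum_pow_smul ha).hasFPowerSeriesAt
    |>.eq_formalMultilinearSeries_of_eventually
      (hasFPowerSeriesOnBall_tsum_pow_smul hb).hasFPowerSeriesAt
      (Filter.eventually_of_mem (Metric.ball_mem_nhds (0 : ℂ) one_pos) h)
  funext n
  simpa using congrArg (fun p : FormalMultilinearSeries ℂ ℂ X => p n fun _ => 1) hab

end PowerSeries

section SquareSummable

variable {ι : Type*} {E : ι → Type*} [∀ i, NormedAddCommGroup (E i)]

theorem memℓp_two_iff {f : ∀ i, E i} : Memℓp f 2 ↔ Summable fun i => ‖f i‖ ^ 2 := by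
  simpa using memℓp_gen_iff (E := E) (f := f) (p := 2) (by norm_num)

theorem hasSum_norm_sq_lp (f : lp E 2) : HasSum (fun i => ‖f i‖ ^ 2) (‖f‖ ^ 2) := by
  simpa using lp.hasSum_norm (p := 2) (by norm_num) f

end SquareSummable

section Evaluation

variable {E : Type*} [NormedAddCommGroup E] [NormedSpace ℂ E]

theorem hardyEval_at_zero (f : Hardy E) : hardyEval f 0 = f 0 := by
  rw [hardyEval, tsum_eq_single 0 (fun n hn => by simp [hn])]
  simp

theorem hardyEval_single (n : ℕ) (e : E) (z : ℂ) :
    hardyEval (lp.single 2 n e : Hardy E) z = z ^ n • e := by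
  rw [hardyEval, tsum_eq_single n (fun m hm => by simp [hm])]
  simp

theorem norm_evalCLM_le_one (n : ℕ) : ‖lp.evalCLM ℂ (fun _ : ℕ => E) 2 n‖ ≤ 1 :=
  ContinuousLinearMap.opNorm_le_bound _ zero_le_one fun f =>
    (lp.norm_apply_le_norm two_ne_zero f n).trans_eq (one_mul _).symm

/-- Evaluation at `z` as a bounded operator on `H²(𝔻; E)`; meaningful only for `z ∈ 𝔻`. -/
def hardyEvalL (E : Type*) [NormedAddCommGroup E] [NormedSpace ℂ E] (z : ℂ) : Hardy E →L[ℂ] E :=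
  ∑' n : ℕ, z ^ n • lp.evalCLM ℂ (fun _ : ℕ => E) 2 n

variable [CompleteSpace E]

theorem hardyEval_ext {f g : Hardy E} (h : ∀ z ∈ unitDisc, hardyEval f z = hardyEval g z) :
    f = g := by
  ext1
  exact eq_of_tsum_pow_smul_eqOn (fun n => lp.norm_apply_le_norm two_ne_zero f n)
    (fun n => lp.norm_apply_le_norm two_ne_zero g n) h

theorem differentiableOn_hardyEvalL : DifferentiableOn ℂ (hardyEvalL E) unitDisc :=
  differentiableOn_tsum_pow_smul norm_evalCLM_le_one

@[simp]
theorem hardyEvalL_apply {z : ℂ} (hz : z ∈ unitDisc) (f : Hardy E) :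
    hardyEvalL E z f = hardyEval f z := by
  have hz' : ‖z‖ < 1 := by simpa using hz
  have hs : Summable fun n : ℕ => z ^ n • lp.evalCLM ℂ (fun _ : ℕ => E) 2 n :=
    .of_norm_bounded (summable_geometric_of_lt_one (norm_nonneg z) hz') fun n => by
      rw [norm_smul, norm_pow]
      exact mul_le_of_le_one_right (by positivity) (norm_evalCLM_le_one n)
  rw [hardyEvalL, hardyEval,
    ← ContinuousLinearMap.apply_apply f (∑' n : ℕ, z ^ n • lp.evalCLM ℂ (fun _ : ℕ => E) 2 n),
    ContinuousLinearMap.map_tsum _ hs]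
  rfl

end Evaluation

section SzegoKernel

variable {E : Type*} [NormedAddCommGroup E] [InnerProductSpace ℂ E] [CompleteSpace E] {z : ℂ}

open ContinuousLinearMap (adjoint)

theorem one_sub_norm_sq_pos (hz : z ∈ unitDisc) : 0 < 1 - ‖z‖ ^ 2 := by
  have hz' : ‖z‖ < 1 := by simpa using hz
  nlinarith [norm_nonneg z]

-- `(hardyEvalL E z)† e` is the Szegő kernel `w ↦ (1 - z̄ w)⁻¹ e`.
theorem adjoint_hardyEvalL_apply (hz : z ∈ unitDisc) (e : E) (n : ℕ) :
    adjoint (hardyEvalL E z) e n = conj z ^ n • e := by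
  refine ext_inner_left ℂ fun x => ?_
  calc inner ℂ x (adjoint (hardyEvalL E z) e n)
      = inner ℂ (lp.single 2 n x : Hardy E) (adjoint (hardyEvalL E z) e) :=
        (lp.inner_single_left (G := fun _ : ℕ => E) n x _).symm
    _ = inner ℂ x (conj z ^ n • e) := by
        rw [ContinuousLinearMap.adjoint_inner_right, hardyEvalL_apply hz, hardyEval_single,
          inner_smul_left, inner_smul_right, map_pow]

theorem hardyEval_adjoint_hardyEvalL (hz : z ∈ unitDisc) (e : E) :
    hardyEval (adjoint (hardyEvalL E z) e) z = ((1 - ‖z‖ ^ 2 : ℝ) : ℂ)⁻¹ • e := by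
  have hg := hasSum_geometric_of_lt_one (sq_nonneg ‖z‖) (by linarith [one_sub_norm_sq_pos hz])
  rw [hardyEval, ← Complex.ofReal_inv, ← ((Complex.hasSum_ofReal.2 hg).smul_const e).tsum_eq]
  refine tsum_congr fun n => ?_
  rw [adjoint_hardyEvalL_apply hz, smul_smul, ← mul_pow, Complex.mul_conj,
    Complex.normSq_eq_norm_sq, Complex.ofReal_pow (‖z‖ ^ 2), Complex.ofReal_pow]

theorem norm_adjoint_hardyEvalL_sq (hz : z ∈ unitDisc) (e : E) :
    ‖adjoint (hardyEvalL E z) e‖ ^ 2 = (1 - ‖z‖ ^ 2)⁻¹ * ‖e‖ ^ 2 := by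
  have h : inner ℂ (adjoint (hardyEvalL E z) e) (adjoint (hardyEvalL E z) e)
      = ((1 - ‖z‖ ^ 2 : ℝ) : ℂ)⁻¹ * inner ℂ e e := by
    rw [ContinuousLinearMap.adjoint_inner_left, hardyEvalL_apply hz,
      hardyEval_adjoint_hardyEvalL hz, inner_smul_right]
  rw [inner_self_eq_norm_sq_to_K, inner_self_eq_norm_sq_to_K] at h
  exact Complex.ofReal_injective (by simpa using h)

theorem norm_hardyEval_sq_le (hz : z ∈ unitDisc) (f : Hardy E) :
    ‖hardyEval f z‖ ^ 2 ≤ (1 - ‖z‖ ^ 2)⁻¹ * ‖f‖ ^ 2 := by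
  set k := adjoint (hardyEvalL E z) (hardyEval f z)
  have hpos := one_sub_norm_sq_pos hz
  rcases eq_or_ne (hardyEval f z) 0 with h0 | h0
  · rw [h0, norm_zero, zero_pow two_ne_zero]
    positivity
  have hk : ‖hardyEval f z‖ ^ 2 ≤ ‖k‖ * ‖f‖ := by
    have h : inner ℂ k f = (‖hardyEval f z‖ : ℂ) ^ 2 := by
      rw [ContinuousLinearMap.adjoint_inner_left, hardyEvalL_apply hz, inner_self_eq_norm_sq_to_K]
      rfl
    simpa [h] using norm_inner_le_norm (𝕜 := ℂ) k f
  have hsq : (‖hardyEval f z‖ ^ 2) ^ 2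
      ≤ ‖hardyEval f z‖ ^ 2 * ((1 - ‖z‖ ^ 2)⁻¹ * ‖f‖ ^ 2) :=
    calc (‖hardyEval f z‖ ^ 2) ^ 2 ≤ (‖k‖ * ‖f‖) ^ 2 := by gcongr
      _ = _ := by rw [mul_pow, norm_adjoint_hardyEvalL_sq hz]; ring
  exact le_of_mul_le_mul_left (by rwa [← sq]) (by positivity)

end SzegoKernel

theorem pow_apply_mem {𝕜 H : Type*} [NormedField 𝕜] [NormedAddCommGroup H] [NormedSpace 𝕜 H]
    {S : H →ₗᵢ[𝕜] H} {N : Submodule 𝕜 H} (hN : ∀ x ∈ N, S x ∈ N) {x : H} (hx : x ∈ N) (n : ℕ) :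
    (S ^ n) x ∈ N := by
  induction n with
  | zero => simpa using hx
  | succ n ih => exact pow_succ' S n ▸ hN _ ih

section Wold

variable {𝕜 G H : Type*} [RCLike 𝕜] [NormedAddCommGroup G] [InnerProductSpace 𝕜 G]
  [NormedAddCommGroup H] [InnerProductSpace 𝕜 H]

/-- The wandering subspace `N ⊖ S N` of a subspace `N` invariant under the isometry `S`; by the
Wold decomposition `N` is the orthogonal sum of its images under the powers of `S` whenever `S`
is pure. -/
def wanderingSubspace (S : H →ₗᵢ[𝕜] H) (N : Submodule 𝕜 H) : Submodule 𝕜 H :=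
  N ⊓ (N.map S.toLinearMap)ᗮ

variable {S : H →ₗᵢ[𝕜] H} {N : Submodule 𝕜 H}

theorem orthogonalFamily_pow_comp (hN : ∀ x ∈ N, S x ∈ N) {j : G →ₗᵢ[𝕜] H}
    (hj : ∀ a, j a ∈ wanderingSubspace S N) :
    OrthogonalFamily 𝕜 (fun _ : ℕ => G) fun n => (S ^ n).comp j := by
  have key (n k : ℕ) (a b : G) : inner 𝕜 ((S ^ n) (j a)) ((S ^ (n + k + 1)) (j b)) = 0 := by
    have hsplit : (S ^ (n + k + 1)) (j b) = (S ^ n) (S ((S ^ k) (j b))) := by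
      rw [add_assoc, pow_add, pow_succ']
      rfl
    rw [hsplit, LinearIsometry.inner_map_map]
    exact Submodule.inner_left_of_mem_orthogonal
      (Submodule.mem_map_of_mem (pow_apply_mem hN (hj b).1 k)) (hj a).2
  intro n m hnm a b
  rcases lt_or_gt_of_ne hnm with h | h
  · obtain ⟨k, rfl⟩ := Nat.exists_eq_add_of_lt h
    exact key n k a b
  · obtain ⟨k, rfl⟩ := Nat.exists_eq_add_of_lt h
    exact inner_eq_zero_symm.1 (key m k b a)

theorem isClosed_wanderingSubspace (hN : IsClosed (N : Set H)) :
    IsClosed (wanderingSubspace S N : Set H) :=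
  hN.inter (Submodule.isClosed_orthogonal _)

variable [CompleteSpace H]

theorem inf_orthogonal_wanderingSubspace_le (hNc : IsClosed (N : Set H))
    (hN : ∀ x ∈ N, S x ∈ N) : N ⊓ (wanderingSubspace S N)ᗮ ≤ N.map S.toLinearMap := by
  have : CompleteSpace (N.map S.toLinearMap) := by
    refine IsComplete.completeSpace_coe ?_
    simpa using (S.isometry.isUniformInducing.isComplete_iff (s := (N : Set H))).2 hNc.isComplete
  have hle : N.map S.toLinearMap ≤ N := Submodule.map_le_iff_le_comap.2 hN
  rintro u ⟨huN, hu⟩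
  rw [SetLike.mem_coe, ← Submodule.sup_orthogonal_inf_of_hasOrthogonalProjection hle] at huN
  obtain ⟨s, hs, t, ht, rfl⟩ := Submodule.mem_sup.1 huN
  have hts : inner 𝕜 t s = 0 := Submodule.inner_left_of_mem_orthogonal hs ht.1
  have htu : inner 𝕜 t (s + t) = 0 := Submodule.inner_right_of_mem_orthogonal ht.symm hu
  rw [inner_add_right, hts, zero_add] at htu
  rwa [inner_self_eq_zero.1 htu, add_zero]

variable [CompleteSpace G]

theorem range_linearIsometry_pow_comp (hS : ∀ x, (∀ n, x ∈ Set.range ⇑(S ^ n)) → x = 0)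
    (hNc : IsClosed (N : Set H)) (hN : ∀ x ∈ N, S x ∈ N) {j : G →ₗᵢ[𝕜] H}
    (hj : j.range = wanderingSubspace S N)
    (hO : OrthogonalFamily 𝕜 (fun _ : ℕ => G) fun n => (S ^ n).comp j) :
    hO.linearIsometry.range = N := by
  set R := hO.linearIsometry.range with hR
  have hj' (a : G) : j a ∈ wanderingSubspace S N := hj ▸ ⟨a, rfl⟩
  have hjR (n : ℕ) (a : G) : (S ^ n) (j a) ∈ R :=
    ⟨lp.single 2 n a, hO.linearIsometry_apply_single a⟩
  have hRN : R ≤ N := by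
    rw [hR, hO.range_linearIsometry]
    refine Submodule.topologicalClosure_minimal _ (iSup_le fun n => ?_) hNc
    rintro _ ⟨a, rfl⟩
    exact pow_apply_mem hN (hj' a).1 n
  have : CompleteSpace R := by
    refine IsComplete.completeSpace_coe ?_
    rw [hR, LinearMap.coe_range]
    exact hO.linearIsometry.isometry.isUniformInducing.isComplete_range
  have hpow (y : H) (hyN : y ∈ N) (hyR : y ∈ Rᗮ) (n : ℕ) : ∃ u ∈ N, (S ^ n) u = y := by
    induction n with
    | zero => exact ⟨y, hyN, rfl⟩
    | succ n ih =>
      obtain ⟨u, huN, rfl⟩ := ih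
      have hu : u ∈ (wanderingSubspace S N)ᗮ := by
        rw [← hj]
        rintro _ ⟨a, rfl⟩
        simpa using Submodule.inner_right_of_mem_orthogonal (hjR n a) hyR
      obtain ⟨v, hv, rfl⟩ := inf_orthogonal_wanderingSubspace_le hNc hN ⟨huN, hu⟩
      exact ⟨v, hv, by rw [pow_succ]; rfl⟩
  have hbot : Rᗮ ⊓ N = ⊥ := by
    refine (Submodule.eq_bot_iff _).2 fun y hy => hS y fun n => ?_
    obtain ⟨u, -, hu⟩ := hpow y hy.2 hy.1 n
    exact ⟨u, hu⟩
  rw [← Submodule.sup_orthogonal_inf_of_hasOrthogonalProjection hRN, hbot, sup_bot_eq]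

end Wold

section Coefficientwise

variable {E F : Type*} [NormedAddCommGroup E] [NormedAddCommGroup F]

section Normed

variable [NormedSpace ℂ E] [NormedSpace ℂ F]

theorem memℓp_two_comp (i : E →L[ℂ] F) (f : Hardy E) : Memℓp (fun n => i (f n)) 2 :=
  memℓp_two_iff.2 <| .of_nonneg_of_le (fun _ => sq_nonneg _)
    (fun n => (pow_le_pow_left₀ (norm_nonneg _) (i.le_opNorm (f n)) 2).trans_eq (mul_pow _ _ 2))
    ((hasSum_norm_sq_lp f).summable.mul_left (‖i‖ ^ 2))

/-- The operator `H²(𝔻; E) → H²(𝔻; F)` that applies `i` to every Taylor coefficient; on functions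
it is `f ↦ i ∘ f`. -/
def hardyMap (i : E →L[ℂ] F) : Hardy E →L[ℂ] Hardy F :=
  LinearMap.mkContinuous
    { toFun f := ⟨fun n => i (f n), memℓp_two_comp i f⟩
      map_add' f g := lp.ext <| funext fun n => map_add i (f n) (g n)
      map_smul' c f := lp.ext <| funext fun n => map_smul i c (f n) }
    ‖i‖ fun f => by
      refine le_of_sq_le_sq ?_ (by positivity)
      rw [mul_pow]
      refine hasSum_le (fun n => ?_) (hasSum_norm_sq_lp _)
        ((hasSum_norm_sq_lp f).mul_left (‖i‖ ^ 2))
      exact (pow_le_pow_left₀ (norm_nonneg _) (i.le_opNorm (f n)) 2).trans_eq (mul_pow _ _ 2)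

@[simp]
theorem hardyMap_apply (i : E →L[ℂ] F) (f : Hardy E) (n : ℕ) : hardyMap i f n = i (f n) :=
  rfl

theorem hardyEval_hardyMap [CompleteSpace E] (i : E →L[ℂ] F) (f : Hardy E) {z : ℂ}
    (hz : z ∈ unitDisc) : hardyEval (hardyMap i f) z = i (hardyEval f z) := by
  simp [hardyEval, i.map_tsum (hardyEval_summable f hz)]

/-- The subspace `H²(𝔻; A)` of `H²(𝔻; F)`, for a subspace `A` of `F`. -/
def hardySubspace (A : Submodule ℂ F) : Submodule ℂ (Hardy F) where
  carrier := {f | ∀ n, f n ∈ A}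
  add_mem' hf hg n := A.add_mem (hf n) (hg n)
  zero_mem' _ := A.zero_mem
  smul_mem' c _ hf n := A.smul_mem c (hf n)

theorem hardySubspace_mono {A B : Submodule ℂ F} (h : A ≤ B) :
    hardySubspace A ≤ hardySubspace B :=
  fun _ hf n => h (hf n)

theorem hardySubspace_inf (A B : Submodule ℂ F) :
    hardySubspace (A ⊓ B) = hardySubspace A ⊓ hardySubspace B :=
  Submodule.ext fun _ => forall_and

theorem isClosed_hardySubspace {A : Submodule ℂ F} (hA : IsClosed (A : Set F)) :
    IsClosed (hardySubspace A : Set (Hardy F)) := by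
  have h : (hardySubspace A : Set (Hardy F))
      = ⋂ n, lp.evalCLM ℂ (fun _ : ℕ => F) 2 n ⁻¹' (A : Set F) := by
    ext f
    simp only [Set.mem_iInter]
    rfl
  exact h ▸ isClosed_iInter fun n => hA.preimage (ContinuousLinearMap.continuous _)

theorem hardySubspace_range {i : E →L[ℂ] F} {r : F →L[ℂ] E} (h : i ∘L r ∘L i = i) :
    hardySubspace i.range = (hardyMap i).range := by
  refine le_antisymm (fun f hf => ?_) ?_
  · refine ⟨hardyMap r f, lp.ext <| funext fun n => ?_⟩
    obtain ⟨x, hx⟩ := hf n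
    change i (r (f n)) = f n
    rw [← hx]
    exact DFunLike.congr_fun h x
  · rintro _ ⟨f, rfl⟩ n
    exact ⟨f n, rfl⟩

end Normed

section InnerProduct

variable [InnerProductSpace ℂ E] [InnerProductSpace ℂ F]

theorem hardySubspace_orthogonal (A : Submodule ℂ F) :
    (hardySubspace A)ᗮ = hardySubspace Aᗮ := by
  refine le_antisymm (fun f hf n a ha => ?_) fun f hf g hg => ?_
  · have hmem : (lp.single 2 n a : Hardy F) ∈ hardySubspace A := fun k => by
      by_cases hk : k = n
      · subst hk; simpa using ha
      · simp [hk]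
    exact (lp.inner_single_left (G := fun _ : ℕ => F) n a f).symm.trans (hf _ hmem)
  · rw [lp.inner_eq_tsum]
    exact (tsum_congr fun n => hf n _ (hg n)).trans tsum_zero

theorem isOrtho_hardySubspace {A B : Submodule ℂ F} (h : A ⟂ B) :
    hardySubspace A ⟂ hardySubspace B := by
  rw [Submodule.isOrtho_iff_le, hardySubspace_orthogonal]
  exact hardySubspace_mono h

theorem hardySubspace_sup [CompleteSpace F] {A B : Submodule ℂ F} (hA : IsClosed (A : Set F))
    (hAB : A ⟂ B) : hardySubspace (A ⊔ B) = hardySubspace A ⊔ hardySubspace B := by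
  have := (isClosed_hardySubspace hA).completeSpace_coe
  have hB : Aᗮ ⊓ (A ⊔ B) = B := by
    rw [inf_comm, sup_comm, sup_inf_assoc_of_le A hAB.symm, A.inf_orthogonal_eq_bot, sup_bot_eq]
  rw [← Submodule.sup_orthogonal_inf_of_hasOrthogonalProjection
    (hardySubspace_mono (le_sup_left : A ≤ A ⊔ B)), hardySubspace_orthogonal,
    ← hardySubspace_inf, hB]

theorem hardySubspace_span_singleton (x : F) :
    hardySubspace (ℂ ∙ x) = (hardyMap (ContinuousLinearMap.toSpanSingleton ℂ x)).range := by
  have hspan : ℂ ∙ x = (ContinuousLinearMap.toSpanSingleton ℂ x).range :=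
    (LinearMap.range_toSpanSingleton x).symm
  rw [hspan]
  refine hardySubspace_range (r := ((‖x‖ : ℂ) ^ 2)⁻¹ • innerSL ℂ x) ?_
  ext
  rcases eq_or_ne x 0 with rfl | hx
  · simp
  · simp [inner_self_eq_norm_sq_to_K, hx]

theorem hardySubspace_range_linearIsometry [CompleteSpace E] [CompleteSpace F]
    (V : E →ₗᵢ[ℂ] F) : hardySubspace V.range = (hardyMap V.toContinuousLinearMap).range := by
  refine hardySubspace_range (i := V.toContinuousLinearMap)
    (r := ContinuousLinearMap.adjoint V.toContinuousLinearMap) ?_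
  rw [V.toContinuousLinearMap.norm_map_iff_adjoint_comp_self.1 V.norm_map]
  rfl

end InnerProduct

end Coefficientwise

section HardyShift

section CoeffPush

variable {ι κ F : Type*} [NormedAddCommGroup F] [NormedSpace ℂ F] {e : ι → κ}
  (he : Function.Injective e) (f : lp (fun _ : ι => F) 2)

theorem coeffPush_apply (i : ι) : coeffPush e he f (e i) = f i :=
  he.extend_apply _ _ _

theorem coeffPush_apply_of_notMem {k : κ} (hk : k ∉ Set.range e) : coeffPush e he f k = 0 :=
  Function.extend_apply' _ _ _ hk

end CoeffPush

variable {F : Type*} [NormedAddCommGroup F] [NormedSpace ℂ F]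

/-- The unilateral shift on `H²(𝔻; F)`, that is, multiplication by the independent variable. -/
def hardyShift (F : Type*) [NormedAddCommGroup F] [NormedSpace ℂ F] : Hardy F →ₗᵢ[ℂ] Hardy F :=
  coeffPush Nat.succ Nat.succ_injective

@[simp]
theorem hardyShift_apply_succ (f : Hardy F) (n : ℕ) : hardyShift F f (n + 1) = f n :=
  coeffPush_apply Nat.succ_injective f n

@[simp]
theorem hardyShift_apply_zero (f : Hardy F) : hardyShift F f 0 = 0 :=
  coeffPush_apply_of_notMem Nat.succ_injective f (by simp)

theorem hardyShift_single (n : ℕ) (a : F) :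
    hardyShift F (lp.single 2 n a) = lp.single 2 (n + 1) a := by
  ext k
  cases k with
  | zero => simp
  | succ k => by_cases h : k = n <;> simp [h]

theorem hardyShift_pow_single_zero (n : ℕ) (a : F) :
    (hardyShift F ^ n) (lp.single 2 0 a) = lp.single 2 n a := by
  induction n with
  | zero => rfl
  | succ n ih => rw [pow_succ', ← hardyShift_single, ← ih]; rfl

theorem hardyShift_pow_apply_of_lt (f : Hardy F) {n k : ℕ} (hk : k < n) :
    (hardyShift F ^ n) f k = 0 := by
  induction n generalizing k with
  | zero => omega
  | succ n ih =>
    rw [pow_succ']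
    change hardyShift F ((hardyShift F ^ n) f) k = 0
    cases k with
    | zero => simp
    | succ k => simpa using ih (by omega)

theorem eq_zero_of_mem_range_hardyShift_pow {f : Hardy F}
    (hf : ∀ n, f ∈ Set.range ⇑(hardyShift F ^ n)) : f = 0 := by
  ext k
  obtain ⟨u, rfl⟩ := hf (k + 1)
  simpa using hardyShift_pow_apply_of_lt u (Nat.lt_succ_self k)

theorem hardySubspace_le {A : Submodule ℂ F} {N : Submodule ℂ (Hardy F)}
    (hN : IsInvariantSubspace (hardyShift F).toContinuousLinearMap N)
    (hA : ∀ a ∈ A, lp.single 2 0 a ∈ N) : hardySubspace A ≤ N := by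
  intro f hf
  have hmem (n : ℕ) (a : F) (ha : a ∈ A) : lp.single 2 n a ∈ N := by
    rw [← hardyShift_pow_single_zero]
    exact pow_apply_mem hN.2 (hA a ha) n
  exact hN.1.mem_of_tendsto (lp.hasSum_single ENNReal.ofNat_ne_top f)
    (.of_forall fun s => N.sum_mem fun n _ => hmem n (f n) (hf n))

theorem hardyMap_hardyShift {E : Type*} [NormedAddCommGroup E] [NormedSpace ℂ E] (i : E →L[ℂ] F)
    (f : Hardy E) : hardyMap i (hardyShift E f) = hardyShift F (hardyMap i f) := by
  ext n
  cases n <;> simp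

variable [CompleteSpace F]

theorem hardyEval_hardyShift (f : Hardy F) {z : ℂ} (hz : z ∈ unitDisc) :
    hardyEval (hardyShift F f) z = z • hardyEval f z := by
  rw [hardyEval, (hardyEval_summable (hardyShift F f) hz).tsum_eq_zero_add, hardyEval,
    ← (hardyEval_summable f hz).tsum_const_smul]
  simp [pow_succ', mul_smul]

theorem hardyEval_hardyShift_pow (f : Hardy F) {z : ℂ} (hz : z ∈ unitDisc) (n : ℕ) :
    hardyEval ((hardyShift F ^ n) f) z = z ^ n • hardyEval f z := by
  induction n with
  | zero => simp
  | succ n ih =>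
    rw [pow_succ', pow_succ', mul_smul, ← ih]
    exact hardyEval_hardyShift _ hz

end HardyShift

section InnerFunction

variable {E F : Type*} [NormedAddCommGroup E] [InnerProductSpace ℂ E] [CompleteSpace E]
  [NormedAddCommGroup F] [InnerProductSpace ℂ F] [CompleteSpace F] {Ψ : ℂ → E →L[ℂ] F}

namespace IsInnerFunction

theorem of_isometry (hΨ : DifferentiableOn ℂ Ψ unitDisc)
    (h : ∀ f : Hardy E, ∃ g : Hardy F,
      (∀ z ∈ unitDisc, hardyEval g z = Ψ z (hardyEval f z)) ∧ ‖g‖ = ‖f‖) :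
    IsInnerFunction Ψ := by
  refine ⟨hΨ, ⟨1, fun z hz => ContinuousLinearMap.opNorm_le_bound _ zero_le_one fun e => ?_⟩, h⟩
  -- Test the isometry on the Szegő kernel at `z`.
  obtain ⟨g, hg, hgn⟩ := h (ContinuousLinearMap.adjoint (hardyEvalL E z) e)
  have hle := norm_hardyEval_sq_le hz g
  have hpos := one_sub_norm_sq_pos hz
  rw [hg z hz, hgn, hardyEval_adjoint_hardyEvalL hz, norm_adjoint_hardyEvalL_sq hz, map_smul,
    norm_smul, norm_inv, Complex.norm_real, Real.norm_of_nonneg hpos.le] at hle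
  refine le_of_sq_le_sq ?_ (by positivity)
  field_simp at hle
  simpa using hle

/-- Multiplication by an inner function, as an isometry between Hardy spaces. -/
def mulIsometry (hΨ : IsInnerFunction Ψ) : Hardy E →ₗᵢ[ℂ] Hardy F where
  toFun f := (hΨ.isometry f).choose
  map_add' f g := hardyEval_ext fun z hz => by
    simp only [(hΨ.isometry _).choose_spec.1 z hz, hardyEval_add _ _ hz, map_add]
  map_smul' c f := hardyEval_ext fun z hz => by
    simp only [(hΨ.isometry _).choose_spec.1 z hz, hardyEval_smul _ _ hz, map_smul,
      RingHom.id_apply]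
  norm_map' f := (hΨ.isometry f).choose_spec.2

theorem hardyEval_mulIsometry (hΨ : IsInnerFunction Ψ) (f : Hardy E) {z : ℂ}
    (hz : z ∈ unitDisc) : hardyEval (hΨ.mulIsometry f) z = Ψ z (hardyEval f z) :=
  (hΨ.isometry f).choose_spec.1 z hz

theorem mulIsometry_hardyShift (hΨ : IsInnerFunction Ψ) (f : Hardy E) :
    hΨ.mulIsometry (hardyShift E f) = hardyShift F (hΨ.mulIsometry f) :=
  hardyEval_ext fun z hz => by
    rw [hΨ.hardyEval_mulIsometry _ hz, hardyEval_hardyShift _ hz, hardyEval_hardyShift _ hz,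
      hΨ.hardyEval_mulIsometry _ hz, map_smul]

end IsInnerFunction

/-- The operator-valued function `z ↦ (e ↦ (j e)(z))` on `𝔻` attached to an embedding `j` of `E`
into `H²(𝔻; F)`. -/
def symbol (j : E →ₗᵢ[ℂ] Hardy F) (z : ℂ) : E →L[ℂ] F :=
  hardyEvalL F z ∘L j.toContinuousLinearMap

omit [CompleteSpace E] in
theorem symbol_apply (j : E →ₗᵢ[ℂ] Hardy F) {z : ℂ} (hz : z ∈ unitDisc) (e : E) :
    symbol j z e = hardyEval (j e) z :=
  hardyEvalL_apply hz (j e)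

theorem hardyEval_linearIsometry_hardyShift_pow {j : E →ₗᵢ[ℂ] Hardy F}
    (hO : OrthogonalFamily ℂ (fun _ : ℕ => E) fun n => (hardyShift F ^ n).comp j) (f : Hardy E)
    {z : ℂ} (hz : z ∈ unitDisc) :
    hardyEval (hO.linearIsometry f) z = symbol j z (hardyEval f z) := by
  have hleft : HasSum (fun n => symbol j z (z ^ n • f n)) (hardyEval (hO.linearIsometry f) z) := by
    rw [← hardyEvalL_apply hz]
    refine ((hO.hasSum_linearIsometry f).mapL (hardyEvalL F z)).congr_fun fun n => ?_
    rw [map_smul, symbol_apply j hz, hardyEvalL_apply hz]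
    exact (hardyEval_hardyShift_pow (j (f n)) hz n).symm
  exact hleft.unique ((hardyEval_summable f hz).hasSum.mapL (symbol j z))

theorem isInnerFunction_symbol {j : E →ₗᵢ[ℂ] Hardy F}
    (hO : OrthogonalFamily ℂ (fun _ : ℕ => E) fun n => (hardyShift F ^ n).comp j) :
    IsInnerFunction (symbol j) :=
  .of_isometry (differentiableOn_hardyEvalL.clm_comp (differentiableOn_const _)) fun f =>
    ⟨hO.linearIsometry f, fun _ hz => hardyEval_linearIsometry_hardyShift_pow hO f hz,
      hO.linearIsometry.norm_map f⟩

/-- The Beurling–Lax–Halmos theorem. -/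
theorem exists_range_mulIsometry_symbol_eq {N : Submodule ℂ (Hardy F)}
    (hN : IsInvariantSubspace (hardyShift F).toContinuousLinearMap N) {j : E →ₗᵢ[ℂ] Hardy F}
    (hj : j.range = wanderingSubspace (hardyShift F) N) :
    ∃ hΨ : IsInnerFunction (symbol j), hΨ.mulIsometry.range = N := by
  have hinv : ∀ f ∈ N, hardyShift F f ∈ N := hN.2
  have hmem (e : E) : j e ∈ wanderingSubspace (hardyShift F) N := by
    rw [← hj]
    exact ⟨e, rfl⟩
  have hO := orthogonalFamily_pow_comp hinv hmem
  have hΨ := isInnerFunction_symbol hO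
  have hV : hΨ.mulIsometry = hO.linearIsometry := by
    refine LinearIsometry.ext fun f => hardyEval_ext fun z hz => ?_
    rw [hΨ.hardyEval_mulIsometry f hz, hardyEval_linearIsometry_hardyShift_pow hO f hz]
  refine ⟨hΨ, ?_⟩
  rw [hV]
  have hpure (f : Hardy F) (hf : ∀ n, f ∈ Set.range ⇑(hardyShift F ^ n)) : f = 0 :=
    eq_zero_of_mem_range_hardyShift_pow hf
  exact range_linearIsometry_pow_comp (N := N) (j := j) hpure hN.1 hinv hj hO

end InnerFunction

section Beurling

-- Both `Ψ(z)x Ψ(z)y` and its rearrangement are `Ψ` applied to elements of `H²(𝔻; E)`, namely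
-- to `(Ψ x) ⊗ y` and `(Ψ y) ⊗ x`.
theorem IsInnerFunction.mem_span_singleton {E : Type*} [NormedAddCommGroup E]
    [InnerProductSpace ℂ E] [CompleteSpace E] {Ψ : ℂ → E →L[ℂ] ℂ} (hΨ : IsInnerFunction Ψ) {x : E}
    (hx : x ≠ 0) (y : E) : y ∈ ℂ ∙ x := by
  let f (e : E) : Hardy ℂ := hΨ.mulIsometry (lp.single 2 0 e)
  have hf (e : E) {z : ℂ} (hz : z ∈ unitDisc) : hardyEval (f e) z = Ψ z e := by
    rw [hΨ.hardyEval_mulIsometry _ hz, hardyEval_single, pow_zero, one_smul]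
  let tensor (e : E) : Hardy ℂ →L[ℂ] Hardy E := hardyMap (ContinuousLinearMap.toSpanSingleton ℂ e)
  have hcomm : tensor y (f x) = tensor x (f y) := by
    refine hΨ.mulIsometry.injective (hardyEval_ext fun z hz => ?_)
    simp only [tensor, hΨ.hardyEval_mulIsometry _ hz, hardyEval_hardyMap _ _ hz, hf _ hz,
      ContinuousLinearMap.toSpanSingleton_apply, map_smul, smul_eq_mul, mul_comm]
  have hfx : f x ≠ 0 := by
    rw [← norm_ne_zero_iff, hΨ.mulIsometry.norm_map, lp.norm_single two_pos]
    exact norm_ne_zero_iff.2 hx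
  obtain ⟨n, hn⟩ : ∃ n, f x n ≠ 0 := by
    by_contra! h
    exact hfx (lp.ext (funext h))
  have hn' : f x n • y = f y n • x :=
    congrFun (congrArg (fun h : Hardy E => (h : ℕ → E)) hcomm) n
  refine Submodule.mem_span_singleton.2 ⟨(f x n)⁻¹ * f y n, ?_⟩
  rw [mul_smul, ← hn', inv_smul_smul₀ hn]

namespace IsScalarInner

variable {φ : ℂ → ℂ}

/-- Multiplication by a scalar inner function, as an isometry of `H²(𝔻)`. -/
def mulIsometry (hφ : IsScalarInner φ) : Hardy ℂ →ₗᵢ[ℂ] Hardy ℂ :=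
  IsInnerFunction.mulIsometry hφ

theorem hardyEval_mulIsometry (hφ : IsScalarInner φ) (f : Hardy ℂ) {z : ℂ} (hz : z ∈ unitDisc) :
    hardyEval (hφ.mulIsometry f) z = φ z * hardyEval f z :=
  IsInnerFunction.hardyEval_mulIsometry hφ f hz

theorem range_mulIsometry (hφ : IsScalarInner φ) : hφ.mulIsometry.range = mulHardy φ := by
  ext f
  constructor
  · rintro ⟨h, rfl⟩
    exact ⟨h, fun z hz => hφ.hardyEval_mulIsometry h hz⟩
  · rintro ⟨h, hh⟩
    exact ⟨h, hardyEval_ext fun z hz => (hφ.hardyEval_mulIsometry h hz).trans (hh z hz).symm⟩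

theorem isClosed_mulHardy (hφ : IsScalarInner φ) : IsClosed (mulHardy φ : Set (Hardy ℂ)) := by
  rw [← hφ.range_mulIsometry, LinearMap.coe_range]
  exact hφ.mulIsometry.isometry.isClosedEmbedding.isClosed_range

end IsScalarInner

theorem exists_linearIsometry_range_eq_wanderingSubspace {N : Submodule ℂ (Hardy ℂ)}
    (hN : IsInvariantSubspace (hardyShift ℂ).toContinuousLinearMap N) (hne : N ≠ ⊥) :
    ∃ j : ℂ →ₗᵢ[ℂ] Hardy ℂ, j.range = wanderingSubspace (hardyShift ℂ) N := by
  set W := wanderingSubspace (hardyShift ℂ) N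
  have : CompleteSpace W := (isClosed_wanderingSubspace hN.1).completeSpace_coe
  obtain ⟨hΨ, hrange⟩ := exists_range_mulIsometry_symbol_eq (j := W.subtypeₗᵢ) hN W.range_subtype
  obtain ⟨e₀, he₀⟩ : ∃ e₀ : W, e₀ ≠ 0 := by
    by_contra! h
    refine hne (hrange ▸ (LinearMap.range_eq_bot.2 (LinearMap.ext fun f => ?_)))
    rw [show f = 0 from lp.ext (funext fun n => h (f n)), map_zero, map_zero]
  obtain ⟨e, he₁⟩ : ∃ e : W, ‖e‖ = 1 := ⟨_, norm_smul_inv_norm (𝕜 := ℂ) he₀⟩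
  have he : e ≠ 0 := norm_ne_zero_iff.1 (he₁ ▸ one_ne_zero)
  refine ⟨W.subtypeₗᵢ.comp (LinearIsometry.toSpanSingleton ℂ W he₁), le_antisymm ?_ fun x hx => ?_⟩
  · rintro _ ⟨a, rfl⟩
    exact (a • e).2
  · obtain ⟨a, ha⟩ := Submodule.mem_span_singleton.1 (hΨ.mem_span_singleton he ⟨x, hx⟩)
    exact ⟨a, congrArg Subtype.val ha⟩

/-- Beurling's theorem. -/
theorem exists_eq_mulHardy {N : Submodule ℂ (Hardy ℂ)}
    (hN : IsInvariantSubspace (hardyShift ℂ).toContinuousLinearMap N) (hne : N ≠ ⊥) :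
    ∃ φ : ℂ → ℂ, IsScalarInner φ ∧ N = mulHardy φ := by
  obtain ⟨j, hj⟩ := exists_linearIsometry_range_eq_wanderingSubspace hN hne
  obtain ⟨hΨ, rfl⟩ := exists_range_mulIsometry_symbol_eq hN hj
  have hscalar : (fun z => symbol j z 1 • ContinuousLinearMap.id ℂ ℂ) = symbol j := by
    funext z
    ext
    simp
  have hφ : IsScalarInner fun z => symbol j z 1 := by rwa [IsScalarInner, hscalar]
  have hV : hΨ.mulIsometry = hφ.mulIsometry := by
    refine LinearIsometry.ext fun f => hardyEval_ext fun z hz => ?_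
    rw [hΨ.hardyEval_mulIsometry f hz, hφ.hardyEval_mulIsometry f hz, mul_comm, ← smul_eq_mul,
      ← map_smul, smul_eq_mul, mul_one]
  exact ⟨_, hφ, hV ▸ hφ.range_mulIsometry⟩

end Beurling

section InvariantSubspace

universe u

variable {F : Type u} [NormedAddCommGroup F] [InnerProductSpace ℂ F] [CompleteSpace F]

/-- The subspace `Ψ H²(𝔻; E)` of `H²(𝔻; K)`, for `K` a subspace of `F`, seen inside `H²(𝔻; F)`. -/
def IsInnerFunction.mulSubspace {E : Type*} [NormedAddCommGroup E] [InnerProductSpace ℂ E]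
    [CompleteSpace E] {K : Submodule ℂ F} [CompleteSpace K] {Ψ : ℂ → E →L[ℂ] K}
    (hΨ : IsInnerFunction Ψ) : Submodule ℂ (Hardy F) :=
  hΨ.mulIsometry.range.map (hardyMap K.subtypeL).toLinearMap

theorem exists_mulSubspace_eq {K : Submodule ℂ F} [CompleteSpace K]
    {N : Submodule ℂ (Hardy F)} (hN : IsInvariantSubspace (hardyShift F).toContinuousLinearMap N)
    (hNK : N ≤ hardySubspace K) :
    ∃ (E : Type u) (_ : NormedAddCommGroup E) (_ : InnerProductSpace ℂ E) (_ : CompleteSpace E)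
      (Ψ : ℂ → E →L[ℂ] K) (hΨ : IsInnerFunction Ψ), hΨ.mulSubspace = N := by
  set N' := N.comap (hardyMap K.subtypeL).toLinearMap
  have hN' : IsInvariantSubspace (hardyShift K).toContinuousLinearMap N' := by
    refine ⟨hN.1.preimage (hardyMap K.subtypeL).continuous, fun f hf => ?_⟩
    change hardyMap K.subtypeL (hardyShift K f) ∈ N
    rw [hardyMap_hardyShift]
    exact hN.2 _ hf
  set W := wanderingSubspace (hardyShift K) N'
  have : CompleteSpace W := (isClosed_wanderingSubspace hN'.1).completeSpace_coe
  obtain ⟨hΨ, hrange⟩ := exists_range_mulIsometry_symbol_eq (j := W.subtypeₗᵢ) hN' W.range_subtype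
  refine ⟨W, inferInstance, inferInstance, this, symbol W.subtypeₗᵢ, hΨ, ?_⟩
  have hK : hardySubspace K = (hardyMap K.subtypeL).range := by
    have h := hardySubspace_range_linearIsometry K.subtypeₗᵢ
    rwa [show K.subtypeₗᵢ.range = K from K.range_subtype] at h
  rw [IsInnerFunction.mulSubspace, hrange, Submodule.map_comap_eq, inf_eq_right]
  exact hNK.trans_eq hK

theorem exists_eq_hardySubspace_sup_mulSubspace {A K : Submodule ℂ F}
    [CompleteSpace K] (hA : IsClosed (A : Set F)) (hAK : Aᗮ ≤ K)
    {N : Submodule ℂ (Hardy F)} (hN : IsInvariantSubspace (hardyShift F).toContinuousLinearMap N)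
    (hAN : ∀ a ∈ A, lp.single 2 0 a ∈ N) :
    ∃ (E : Type u) (_ : NormedAddCommGroup E) (_ : InnerProductSpace ℂ E) (_ : CompleteSpace E)
      (Ψ : ℂ → E →L[ℂ] K) (hΨ : IsInnerFunction Ψ),
      hardySubspace A ⟂ hΨ.mulSubspace ∧
      N = hardySubspace A ⊔ hΨ.mulSubspace ∧
      ∀ e, (Ψ 0 e : F) ∈ Aᗮ := by
  have := (isClosed_hardySubspace hA).completeSpace_coe
  set N' := (hardySubspace A)ᗮ ⊓ N
  have hN' : IsInvariantSubspace (hardyShift F).toContinuousLinearMap N' := by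
    refine ⟨(Submodule.isClosed_orthogonal _).inter hN.1, fun f hf => ⟨?_, hN.2 f hf.2⟩⟩
    have hfA : f ∈ hardySubspace Aᗮ := hardySubspace_orthogonal A ▸ hf.1
    rw [SetLike.mem_coe, hardySubspace_orthogonal]
    rintro (_ | n)
    · exact (hardyShift_apply_zero f).symm ▸ Aᗮ.zero_mem
    · exact (hardyShift_apply_succ f n).symm ▸ hfA n
  have hN'A : N' ≤ hardySubspace Aᗮ := inf_le_left.trans_eq (hardySubspace_orthogonal A)
  obtain ⟨E, hE₁, hE₂, hE₃, Ψ, hΨ, hrange⟩ :=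
    exists_mulSubspace_eq hN' (hN'A.trans (hardySubspace_mono hAK))
  refine ⟨E, hE₁, hE₂, hE₃, Ψ, hΨ, ?_⟩
  rw [hrange]
  refine ⟨?_, ?_, fun e => ?_⟩
  · exact (Submodule.isOrtho_orthogonal_right _).mono_right inf_le_left
  · exact (Submodule.sup_orthogonal_inf_of_hasOrthogonalProjection (hardySubspace_le hN hAN)).symm
  · have hmem : hardyMap K.subtypeL (hΨ.mulIsometry (lp.single 2 0 e)) ∈ hardySubspace Aᗮ :=
      hN'A (hrange ▸ Submodule.mem_map_of_mem ⟨_, rfl⟩)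
    have h0 : hΨ.mulIsometry (lp.single 2 0 e) 0 = Ψ 0 e := by
      rw [← hardyEval_at_zero, hΨ.hardyEval_mulIsometry _ (Metric.mem_ball_self one_pos),
        hardyEval_single, pow_zero, one_smul]
    exact h0 ▸ hmem 0

end InvariantSubspace

section Bidisc

theorem hasSum_norm_sq_bidisc (f : Hardy (Hardy ℂ)) :
    HasSum (fun p : ℕ × ℕ => ‖f p.1 p.2‖ ^ 2) (‖f‖ ^ 2) := by
  have hrow (n : ℕ) : HasSum (fun m => ‖f n m‖ ^ 2) (‖f n‖ ^ 2) := hasSum_norm_sq_lp (f n)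
  have hs : Summable fun p : ℕ × ℕ => ‖f p.1 p.2‖ ^ 2 :=
    (summable_prod_of_nonneg fun p => sq_nonneg _).2 ⟨fun n => (hrow n).summable,
      (hasSum_norm_sq_lp f).summable.congr fun n => (hrow n).tsum_eq.symm⟩
  exact (hs.hasSum.prod_fiberwise hrow).unique (hasSum_norm_sq_lp f) ▸ hs.hasSum

theorem exists_coeff_coeff_eq (F : HardyBidisc) :
    ∃ f : Hardy (Hardy ℂ), ∀ p : ℕ × ℕ, f p.1 p.2 = F p := by
  have hF := (hasSum_norm_sq_lp F).summable
  let row (n : ℕ) : Hardy ℂ :=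
    ⟨fun m => F (n, m), memℓp_two_iff.2 (hF.comp_injective (Prod.mk_right_injective n))⟩
  have hrow : Memℓp row 2 := memℓp_two_iff.2 <|
    ((summable_prod_of_nonneg fun p => sq_nonneg _).1 hF).2.congr fun n =>
      (hasSum_norm_sq_lp (row n)).tsum_eq
  exact ⟨⟨row, hrow⟩, fun _ => rfl⟩

/-- The identification `H²(𝔻; H²(𝔻)) ≅ H²(𝔻²)`, in which the outer variable is `z₁`. -/
def bidiscEquiv : Hardy (Hardy ℂ) ≃ₗᵢ[ℂ] HardyBidisc :=
  .ofSurjective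
    { toFun f := ⟨fun p => f p.1 p.2, memℓp_two_iff.2 (hasSum_norm_sq_bidisc f).summable⟩
      map_add' _ _ := rfl
      map_smul' _ _ := rfl
      norm_map' f := (sq_eq_sq₀ (norm_nonneg _) (norm_nonneg _)).1 <|
        (hasSum_norm_sq_lp _).unique (hasSum_norm_sq_bidisc f) }
    fun F => (exists_coeff_coeff_eq F).imp fun _ hf => lp.ext (funext hf)

theorem bidiscEquiv_apply (f : Hardy (Hardy ℂ)) (p : ℕ × ℕ) : bidiscEquiv f p = f p.1 p.2 :=
  rfl

theorem bidiscEval_bidiscEquiv (f : Hardy (Hardy ℂ)) {z₁ z₂ : ℂ} (h₁ : z₁ ∈ unitDisc)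
    (h₂ : z₂ ∈ unitDisc) : bidiscEval (bidiscEquiv f) z₁ z₂ = hardyEval (hardyEval f z₁) z₂ := by
  have hrow (n : ℕ) : HasSum (fun m => z₁ ^ n * z₂ ^ m * f n m) (z₁ ^ n • hardyEval (f n) z₂) :=
    ((hardyEval_summable (f n) h₂).hasSum.const_smul (z₁ ^ n)).congr_fun fun m => mul_assoc _ _ _
  have hleft := (bidiscEval_summable (bidiscEquiv f) h₁ h₂).hasSum.prod_fiberwise hrow
  have hright := (hardyEval_summable f h₁).hasSum.mapL (hardyEvalL ℂ z₂)
  rw [hardyEvalL_apply h₂] at hright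
  refine hleft.unique (hright.congr_fun fun n => ?_)
  rw [map_smul]
  exact congrArg (z₁ ^ n • ·) (hardyEvalL_apply h₂ (f n)).symm

theorem bidiscEquiv_hardyShift (f : Hardy (Hardy ℂ)) :
    bidiscEquiv (hardyShift (Hardy ℂ) f) = mulZ₁ (bidiscEquiv f) := by
  have he : Function.Injective fun p : ℕ × ℕ => (p.1 + 1, p.2) := by
    rintro ⟨a, b⟩ ⟨c, d⟩ h
    simpa using h
  ext ⟨n, m⟩
  cases n with
  | zero =>
    refine .trans ?_ (coeffPush_apply_of_notMem he (bidiscEquiv f) (k := (0, m)) (by simp)).symm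
    rw [bidiscEquiv_apply, hardyShift_apply_zero]
    rfl
  | succ n =>
    refine .trans ?_ (coeffPush_apply he (bidiscEquiv f) (n, m)).symm
    rw [bidiscEquiv_apply, hardyShift_apply_succ]
    rfl

theorem bidiscEquiv_single_zero (f : Hardy ℂ) :
    bidiscEquiv (lp.single 2 0 f) = embedJ f := by
  have he : Function.Injective fun n : ℕ => ((0 : ℕ), n) := Prod.mk_right_injective 0
  ext ⟨n, m⟩
  cases n with
  | zero =>
    refine .trans ?_ (coeffPush_apply he f m).symm
    simp [bidiscEquiv_apply]
  | succ n =>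
    refine .trans ?_ (coeffPush_apply_of_notMem he f (k := (n + 1, m)) (by simp)).symm
    simp [bidiscEquiv_apply]

theorem mem_map_bidiscEquiv_range {E : Type*} [NormedAddCommGroup E] [NormedSpace ℂ E]
    (T : Hardy E →ₗ[ℂ] Hardy (Hardy ℂ)) {F : HardyBidisc} :
    F ∈ T.range.map bidiscEquiv.toLinearMap ↔ ∃ h, ∀ z₁ ∈ unitDisc, ∀ z₂ ∈ unitDisc,
      bidiscEval F z₁ z₂ = hardyEval (hardyEval (T h) z₁) z₂ := by
  obtain ⟨f, rfl⟩ := bidiscEquiv.surjective F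
  constructor
  · rintro ⟨_, ⟨h, rfl⟩, hh⟩
    refine ⟨h, fun z₁ h₁ z₂ h₂ => ?_⟩
    rw [← bidiscEval_bidiscEquiv _ h₁ h₂]
    exact congrArg (bidiscEval · z₁ z₂) hh.symm
  · rintro ⟨h, hh⟩
    refine Submodule.mem_map_of_mem ⟨h, hardyEval_ext fun z₁ h₁ => hardyEval_ext fun z₂ h₂ => ?_⟩
    rw [← hh z₁ h₁ z₂ h₂, bidiscEval_bidiscEquiv f h₁ h₂]

theorem IsScalarInner.mulBidisc_eq {φ : ℂ → ℂ} (hφ : IsScalarInner φ) :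
    mulBidisc φ = (hardySubspace (mulHardy φ)).map bidiscEquiv.toLinearMap := by
  ext F
  rw [← hφ.range_mulIsometry, hardySubspace_range_linearIsometry]
  refine bidiscEquiv.surjective.exists.trans (.trans ?_ (mem_map_bidiscEquiv_range _).symm)
  refine exists_congr fun G => forall₄_congr fun z₁ h₁ z₂ h₂ => ?_
  have h : hardyEval (hardyEval (hardyMap hφ.mulIsometry.toContinuousLinearMap G) z₁) z₂
      = φ z₂ * bidiscEval (bidiscEquiv G) z₁ z₂ := by
    rw [hardyEval_hardyMap _ _ h₁, bidiscEval_bidiscEquiv G h₁ h₂]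
    exact hφ.hardyEval_mulIsometry _ h₂
  exact h ▸ Iff.rfl

theorem mulHardyZ₁_eq (g : Hardy ℂ) :
    mulHardyZ₁ g = (hardySubspace (ℂ ∙ g)).map bidiscEquiv.toLinearMap := by
  ext F
  rw [hardySubspace_span_singleton]
  refine .trans ?_ (mem_map_bidiscEquiv_range _).symm
  refine exists_congr fun h => forall₄_congr fun z₁ h₁ z₂ h₂ => ?_
  have hh : hardyEval (hardyEval (hardyMap (ContinuousLinearMap.toSpanSingleton ℂ g) h) z₁) z₂
      = hardyEval g z₂ * hardyEval h z₁ := by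
    rw [hardyEval_hardyMap _ _ h₁, ContinuousLinearMap.toSpanSingleton_apply,
      hardyEval_smul _ _ h₂, smul_eq_mul, mul_comm]
  exact hh ▸ Iff.rfl

theorem IsInnerFunction.mulVector_eq {E : Type*} [NormedAddCommGroup E] [InnerProductSpace ℂ E]
    [CompleteSpace E] {K : Submodule ℂ (Hardy ℂ)} [CompleteSpace K] {Ψ : ℂ → E →L[ℂ] K}
    (hΨ : IsInnerFunction Ψ) : mulVector Ψ = hΨ.mulSubspace.map bidiscEquiv.toLinearMap := by
  ext F
  rw [IsInnerFunction.mulSubspace, ← LinearMap.range_comp, mem_map_bidiscEquiv_range]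
  refine exists_congr fun h => forall₄_congr fun z₁ h₁ z₂ _ => ?_
  have hh : hardyEval (hardyMap K.subtypeL (hΨ.mulIsometry h)) z₁ = Ψ z₁ (hardyEval h z₁) := by
    rw [hardyEval_hardyMap _ _ h₁, hΨ.hardyEval_mulIsometry _ h₁]
    rfl
  exact hh ▸ Iff.rfl

theorem exists_eq_map_hardySubspace_sup_mulVector {A K : Submodule ℂ (Hardy ℂ)} [CompleteSpace K]
    (hA : IsClosed (A : Set (Hardy ℂ))) (hAK : Aᗮ ≤ K) {M : Submodule ℂ HardyBidisc}
    (hM : IsInvariantSubspace mulZ₁ M) (hAM : ∀ a ∈ A, embedJ a ∈ M) :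
    ∃ (E : Type) (_ : NormedAddCommGroup E) (_ : InnerProductSpace ℂ E) (_ : CompleteSpace E)
      (Ψ : ℂ → E →L[ℂ] K), IsInnerFunction Ψ ∧
      (hardySubspace A).map bidiscEquiv.toLinearMap ⟂ mulVector Ψ ∧
      M = (hardySubspace A).map bidiscEquiv.toLinearMap ⊔ mulVector Ψ ∧
      ∀ e, (Ψ 0 e : Hardy ℂ) ∈ Aᗮ := by
  set N := M.comap bidiscEquiv.toLinearMap
  have hN : IsInvariantSubspace (hardyShift (Hardy ℂ)).toContinuousLinearMap N := by
    refine ⟨hM.1.preimage bidiscEquiv.continuous, fun f hf => ?_⟩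
    change bidiscEquiv (hardyShift (Hardy ℂ) f) ∈ M
    rw [bidiscEquiv_hardyShift]
    exact hM.2 _ hf
  have hAN : ∀ a ∈ A, lp.single 2 0 a ∈ N := fun a ha => by
    change bidiscEquiv (lp.single 2 0 a) ∈ M
    rw [bidiscEquiv_single_zero]
    exact hAM a ha
  obtain ⟨E, hE₁, hE₂, hE₃, Ψ, hΨ, horth, hsup, h0⟩ :=
    exists_eq_hardySubspace_sup_mulSubspace hA hAK hN hAN
  refine ⟨E, hE₁, hE₂, hE₃, Ψ, hΨ, ?_, ?_, h0⟩
  · rw [hΨ.mulVector_eq]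
    exact horth.map bidiscEquiv.toLinearIsometry
  · rw [hΨ.mulVector_eq, ← Submodule.map_sup, ← hsup]
    exact (Submodule.map_comap_eq_of_surjective bidiscEquiv.surjective M).symm

end Bidisc

section HilbertSum

variable {H K : Type*} [NormedAddCommGroup H] [NormedSpace ℂ H] [NormedAddCommGroup K]
  [NormedSpace ℂ K]

/-- The section `{x : (x, 0) ∈ M}` of a subspace `M` of `H ⊕ K` along the first summand. -/
def fstSection (M : Submodule ℂ (WithLp 2 (H × K))) : Submodule ℂ H :=
  M.comap ((WithLp.linearEquiv 2 ℂ (H × K)).symm.toLinearMap ∘ₗ LinearMap.inl ℂ H K)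

theorem mem_fstSection {M : Submodule ℂ (WithLp 2 (H × K))} {x : H} :
    x ∈ fstSection M ↔ WithLp.toLp 2 (x, 0) ∈ M :=
  Iff.rfl

theorem isClosed_fstSection {M : Submodule ℂ (WithLp 2 (H × K))}
    (hM : IsClosed (M : Set (WithLp 2 (H × K)))) : IsClosed (fstSection M : Set H) :=
  hM.preimage ((WithLp.prod_continuous_toLp 2 H K).comp (Continuous.prodMk_left 0))

theorem fstSection_hilbertProd (A : Submodule ℂ H) (B : Submodule ℂ K) :
    fstSection (hilbertProd A B) = A :=
  Submodule.ext fun _ => ⟨And.left, fun hx => ⟨hx, B.zero_mem⟩⟩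

theorem hilbertProd_fstSection_bot {M : Submodule ℂ (WithLp 2 (H × K))}
    (hM : ∀ x ∈ M, x.snd = 0) : hilbertProd (fstSection M) ⊥ = M := by
  have hx₀ {x : WithLp 2 (H × K)} (hx : x.snd = 0) : WithLp.toLp 2 (x.fst, 0) = x :=
    WithLp.ofLp_injective 2 (Prod.ext rfl hx.symm)
  refine le_antisymm (fun x hx => ?_) fun x hx => ⟨?_, hM x hx⟩
  · rw [← hx₀ (x := x) hx.2]
    exact hx.1
  · rw [← hx₀ (hM x hx)] at hx
    exact hx

theorem span_sup_hilbertProd_fstSection_bot {M : Submodule ℂ (WithLp 2 (H × ℂ))} {g : H}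
    (hg : WithLp.toLp 2 (g, 1) ∈ M) :
    (ℂ ∙ WithLp.toLp 2 (g, (1 : ℂ))) ⊔ hilbertProd (fstSection M) ⊥ = M := by
  refine le_antisymm (sup_le ((Submodule.span_singleton_le_iff_mem _ _).2 hg) ?_) fun x hx => ?_
  · rintro ⟨x, y⟩ ⟨hx, hy : y = 0⟩
    exact hy ▸ hx
  · have hdecomp : x.snd • WithLp.toLp 2 (g, (1 : ℂ))
        + WithLp.toLp 2 (x.fst - x.snd • g, (0 : ℂ)) = x :=
      WithLp.ofLp_injective 2 (Prod.ext (add_sub_cancel _ _) (by simp))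
    have hmem : WithLp.toLp 2 (x.fst - x.snd • g, (0 : ℂ)) ∈ M := by
      rw [eq_sub_of_add_eq' hdecomp]
      exact M.sub_mem hx (M.smul_mem _ hg)
    rw [← hdecomp]
    exact Submodule.add_mem_sup (Submodule.smul_mem _ _ (Submodule.mem_span_singleton_self _))
      ⟨hmem, rfl⟩

theorem exists_mem_orthogonal_fstSection {H : Type*} [NormedAddCommGroup H]
    [InnerProductSpace ℂ H] [CompleteSpace H] {M : Submodule ℂ (WithLp 2 (H × ℂ))}
    (hM : IsClosed (M : Set (WithLp 2 (H × ℂ)))) {x : WithLp 2 (H × ℂ)} (hx : x ∈ M)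
    (hx₀ : x.snd ≠ 0) : ∃ g ∈ (fstSection M)ᗮ, WithLp.toLp 2 (g, 1) ∈ M := by
  have : CompleteSpace (fstSection M) := (isClosed_fstSection hM).completeSpace_coe
  obtain ⟨p, hp, g, hg, hpg⟩ :=
    (fstSection M).exists_add_mem_mem_orthogonal (x.snd⁻¹ • x.fst)
  have hgx : WithLp.toLp 2 (g, (1 : ℂ)) = x.snd⁻¹ • x - WithLp.toLp 2 (p, 0) :=
    WithLp.ofLp_injective 2 <| Prod.ext (eq_sub_of_add_eq' hpg.symm)
      (.trans (inv_mul_cancel₀ hx₀).symm (sub_zero _).symm)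
  exact ⟨g, hg, hgx ▸ M.sub_mem (M.smul_mem _ hx) hp⟩

end HilbertSum

section Brownian

theorem tendsto_one_sub_mul_hardyEval (g : Hardy ℂ) {w : ℂ} (hw : ‖w‖ = 1) :
    Filter.Tendsto (fun r : ℝ => ((1 - r : ℝ) : ℂ) * hardyEval g (r * w)) (𝓝[<] 1) (𝓝 0) := by
  have hlim : Filter.Tendsto (fun r : ℝ => √((1 - r) * ‖g‖ ^ 2)) (𝓝[<] 1) (𝓝 0) := by
    have hcont : Continuous fun r : ℝ => √((1 - r) * ‖g‖ ^ 2) := by fun_prop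
    simpa using (hcont.tendsto 1).mono_left nhdsWithin_le_nhds
  refine squeeze_zero_norm' ?_ hlim
  filter_upwards [Ioo_mem_nhdsLT zero_lt_one] with r ⟨hr₀, hr₁⟩
  have hnorm : ‖(r : ℂ) * w‖ = r := by simp [hw, abs_of_pos hr₀]
  have hle := norm_hardyEval_sq_le (mem_ball_zero_iff.2 (hnorm.trans_lt hr₁)) g
  rw [hnorm, inv_mul_eq_div, le_div_iff₀ (by nlinarith)] at hle
  rw [norm_mul, Complex.norm_real, Real.norm_of_nonneg (by linarith)]
  refine Real.le_sqrt_of_sq_le ?_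
  calc ((1 - r) * ‖hardyEval g (r * w)‖) ^ 2
      = (1 - r) * ((1 - r) * ‖hardyEval g (r * w)‖ ^ 2) := by ring
    _ ≤ (1 - r) * ‖g‖ ^ 2 := by
        refine mul_le_mul_of_nonneg_left (.trans ?_ hle) (by linarith)
        rw [mul_comm]
        exact mul_le_mul_of_nonneg_left (by nlinarith) (sq_nonneg _)

theorem sub_ne_zero_of_mem_unitDisc {z w : ℂ} (hz : z ∈ unitDisc) (hw : ‖w‖ = 1) : z - w ≠ 0 := by
  rintro h
  rw [sub_eq_zero.1 h, mem_ball_zero_iff] at hz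
  exact hz.ne hw

theorem eq_zero_of_apply_eq_smul_apply_succ {F : Type*} [NormedAddCommGroup F] [NormedSpace ℂ F]
    {y : Hardy F} {w : ℂ} (hw : ‖w‖ = 1) (hy : ∀ n, y n = w • y (n + 1)) : y = 0 := by
  have hconst (n : ℕ) : ‖y n‖ = ‖y 0‖ := by
    induction n with
    | zero => rfl
    | succ n ih => rw [← ih, hy n, norm_smul, hw, one_mul]
  have hlim := (hasSum_norm_sq_lp y).summable.tendsto_atTop_zero
  simp only [hconst] at hlim
  have h₀ : ‖y 0‖ = 0 := by simpa using tendsto_nhds_unique tendsto_const_nhds hlim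
  exact lp.ext (funext fun n => norm_eq_zero.1 ((hconst n).trans h₀))

theorem inner_hardyShift_constEmbed (f : Hardy ℂ) (a : ℂ) :
    inner ℂ (hardyShift ℂ f) (constEmbed a) = 0 := by
  refine (lp.inner_single_right (G := fun _ : ℕ => ℂ) 0 a _).trans ?_
  rw [hardyShift_apply_zero, inner_zero_left]

theorem norm_hardyShift_add_constEmbed_sq (f : Hardy ℂ) (a : ℂ) :
    ‖hardyShift ℂ f + constEmbed a‖ ^ 2 = ‖f‖ ^ 2 + ‖a‖ ^ 2 := by
  have ha : ‖constEmbed a‖ = ‖a‖ := lp.norm_single (E := fun _ : ℕ => ℂ) two_pos 0 a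
  rw [sq, norm_add_sq_eq_norm_sq_add_norm_sq_of_inner_eq_zero _ _ (inner_hardyShift_constEmbed f a),
    LinearIsometry.norm_map, ha, sq, sq]

/-- The first coordinate `(z - w) g(z) + a` of `(B - w)(g, 1)`, where `B` is the Brownian shift
with `σ = a` and `e^{iθ} = w`; its second coordinate is zero. -/
def brownianDefect (a w : ℂ) (g : Hardy ℂ) : Hardy ℂ :=
  hardyShift ℂ g + constEmbed a - w • g

section BrownianDefect

variable {a w : ℂ} {φ : ℂ → ℂ} {g : Hardy ℂ}

theorem hardyEval_brownianDefect {z : ℂ} (hz : z ∈ unitDisc) :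
    hardyEval (brownianDefect a w g) z = (z - w) * hardyEval g z + a := by
  rw [brownianDefect, sub_eq_add_neg, ← neg_smul, hardyEval_add _ _ hz, hardyEval_add _ _ hz,
    hardyEval_smul _ _ hz, hardyEval_hardyShift _ hz, hardyEval_constEmbed, smul_eq_mul,
    smul_eq_mul]
  ring

theorem norm_brownianDefect (hw : ‖w‖ = 1) (h : inner ℂ g (brownianDefect a w g) = 0) :
    ‖brownianDefect a w g‖ = ‖a‖ := by
  have hadd : hardyShift ℂ g + constEmbed a = w • g + brownianDefect a w g :=
    (add_sub_cancel _ _).symm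
  have horth : inner ℂ (w • g) (brownianDefect a w g) = 0 := by
    rw [inner_smul_left, h, mul_zero]
  have hpyth := norm_hardyShift_add_constEmbed_sq g a
  rw [hadd, sq, norm_add_sq_eq_norm_sq_add_norm_sq_of_inner_eq_zero _ _ horth, norm_smul, hw,
    one_mul, ← sq, ← sq, add_right_inj] at hpyth
  exact (sq_eq_sq₀ (norm_nonneg _) (norm_nonneg _)).1 hpyth

theorem inner_mulIsometry_single_succ_brownianDefect (hφ : IsScalarInner φ) (n : ℕ) :
    inner ℂ (hφ.mulIsometry (lp.single 2 (n + 1) 1)) (brownianDefect a w g)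
      = inner ℂ (hφ.mulIsometry (lp.single 2 n 1)) g
        - w * inner ℂ (hφ.mulIsometry (lp.single 2 (n + 1) 1)) g := by
  have hcomm : hφ.mulIsometry (lp.single 2 (n + 1) 1)
      = hardyShift ℂ (hφ.mulIsometry (lp.single 2 n 1)) := by
    rw [← hardyShift_single]
    exact IsInnerFunction.mulIsometry_hardyShift hφ _
  rw [brownianDefect, inner_sub_right, inner_add_right, inner_smul_right]
  congr 1
  rw [hcomm, inner_hardyShift_constEmbed, add_zero, LinearIsometry.inner_map_map]

theorem exists_brownianDefect_eq_mulIsometry (hφ : IsScalarInner φ) (hg : g ∈ modelSpace φ)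
    (hq : brownianDefect a w g ∈ mulHardy φ) :
    ∃ b, brownianDefect a w g = hφ.mulIsometry (lp.single 2 0 b) := by
  rw [modelSpace, ← hφ.range_mulIsometry] at hg
  rw [← hφ.range_mulIsometry] at hq
  obtain ⟨k, hk⟩ := hq
  refine ⟨k 0, hk.symm.trans (congrArg hφ.mulIsometry (lp.ext (funext fun n => ?_)))⟩
  cases n with
  | zero => simp
  | succ n =>
    have hn (m : ℕ) : inner ℂ (hφ.mulIsometry (lp.single 2 m 1)) g = 0 := hg _ ⟨_, rfl⟩
    have hsucc := inner_mulIsometry_single_succ_brownianDefect (a := a) (w := w) (g := g) hφ n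
    rw [hn, hn, mul_zero, sub_zero, ← hk] at hsucc
    have hinner := (hφ.mulIsometry.inner_map_map _ k).symm.trans hsucc
    have hcoeff := (lp.inner_single_left (G := fun _ : ℕ => ℂ) (n + 1) (1 : ℂ) k).symm.trans hinner
    simpa using hcoeff

-- The coefficients of `φ̄ g` form an `ℓ²` eigenvector of the backward shift for the unimodular
-- eigenvalue `w̄`.
theorem mem_modelSpace_of_brownianDefect_eq (hφ : IsScalarInner φ) (hw : ‖w‖ = 1) {b : ℂ}
    (h : brownianDefect a w g = hφ.mulIsometry (lp.single 2 0 b)) : g ∈ modelSpace φ := by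
  set y := ContinuousLinearMap.adjoint hφ.mulIsometry.toContinuousLinearMap g
  have hinner (f : Hardy ℂ) : inner ℂ f y = inner ℂ (hφ.mulIsometry f) g :=
    ContinuousLinearMap.adjoint_inner_right _ f g
  have hcoeff (n : ℕ) : y n = inner ℂ (hφ.mulIsometry (lp.single 2 n 1)) g := by
    rw [← hinner]
    refine .trans ?_ (lp.inner_single_left (G := fun _ : ℕ => ℂ) n (1 : ℂ) y).symm
    simp
  have hy : y = 0 := eq_zero_of_apply_eq_smul_apply_succ hw fun n => by
    have hsucc := inner_mulIsometry_single_succ_brownianDefect (a := a) (w := w) (g := g) hφ n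
    have hzero : inner ℂ (lp.single 2 (n + 1) 1 : Hardy ℂ) (lp.single 2 0 b) = 0 :=
      (lp.inner_single_left (G := fun _ : ℕ => ℂ) (n + 1) (1 : ℂ) _).trans (by simp)
    rw [h, LinearIsometry.inner_map_map, hzero, ← hcoeff, ← hcoeff] at hsucc
    exact sub_eq_zero.1 hsucc.symm
  rw [modelSpace, ← hφ.range_mulIsometry]
  rintro _ ⟨f, rfl⟩
  exact (hinner f).symm.trans (by rw [hy, inner_zero_right])

theorem tendsto_radial_of_eq_mul (hw : ‖w‖ = 1) {b : ℂ} (hb : b ≠ 0)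
    (h : ∀ z ∈ unitDisc, (z - w) * hardyEval g z + a = b * φ z) :
    Filter.Tendsto (fun r : ℝ => φ (r * w)) (𝓝[<] 1) (𝓝 (a / b)) := by
  have hlim : Filter.Tendsto (fun r : ℝ =>
      (a - w * (((1 - r : ℝ) : ℂ) * hardyEval g (r * w))) / b) (𝓝[<] 1) (𝓝 (a / b)) := by
    simpa using
      (((tendsto_one_sub_mul_hardyEval g hw).const_mul w).const_sub a).div_const b
  refine hlim.congr' ?_
  filter_upwards [Ioo_mem_nhdsLT zero_lt_one] with r ⟨hr₀, hr₁⟩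
  have hz : (r : ℂ) * w ∈ unitDisc := by simp [hw, abs_of_pos hr₀, hr₁]
  rw [div_eq_iff hb, mul_comm _ b, ← h _ hz]
  push_cast
  ring

end BrownianDefect

section InvariantSubspaces

variable {σ θ : ℝ} {φ : ℂ → ℂ} {g : Hardy ℂ} {M : Submodule ℂ BrownianSpace}

theorem IsTypeIIPair.mem_modelSpace (h : IsTypeIIPair σ θ φ g) (hφ : IsScalarInner φ) :
    g ∈ modelSpace φ := by
  obtain ⟨c, -, hc⟩ := h
  have hw := Complex.norm_exp_ofReal_mul_I θ
  refine mem_modelSpace_of_brownianDefect_eq (a := σ) (b := σ * conj c) hφ hw ?_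
  refine hardyEval_ext fun z hz => ?_
  have hzw := sub_ne_zero_of_mem_unitDisc hz hw
  rw [hardyEval_brownianDefect hz, hc z hz, hφ.hardyEval_mulIsometry _ hz, hardyEval_single,
    pow_zero, one_smul]
  field_simp
  ring

theorem isTypeIIPair_of_eq_mul (hσ : σ ≠ 0) {b : ℂ} (hb : ‖b‖ = ‖(σ : ℂ)‖)
    (h : ∀ z ∈ unitDisc, (z - Complex.exp (θ * Complex.I)) * hardyEval g z + σ = b * φ z) :
    IsTypeIIPair σ θ φ g := by
  have hw := Complex.norm_exp_ofReal_mul_I θ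
  have hσ' : (σ : ℂ) ≠ 0 := Complex.ofReal_ne_zero.2 hσ
  have hb₀ : b ≠ 0 := norm_ne_zero_iff.1 (hb ▸ norm_ne_zero_iff.2 hσ')
  have hconj : (σ : ℂ) * conj (σ / b : ℂ) = b := by
    have hbb : b * conj b = σ * σ := by
      rw [Complex.mul_conj, Complex.normSq_eq_norm_sq, hb, Complex.norm_real, Real.norm_eq_abs,
        sq_abs]
      push_cast
      ring
    rw [map_div₀, Complex.conj_ofReal, mul_div_assoc', ← hbb,
      mul_div_cancel_right₀ _ ((map_ne_zero _).2 hb₀)]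
  refine ⟨σ / b, tendsto_radial_of_eq_mul hw hb₀ h, fun z hz => ?_⟩
  rw [← mul_div_assoc, eq_div_iff (sub_ne_zero_of_mem_unitDisc hz hw), mul_sub (σ : ℂ), ← mul_assoc,
    hconj, ← h z hz]
  ring

theorem isInvariantSubspace_fstSection_brownianShift
    (hM : IsInvariantSubspace (brownianShift σ θ) M) :
    IsInvariantSubspace (hardyShift ℂ).toContinuousLinearMap (fstSection M) := by
  refine ⟨isClosed_fstSection hM.1, fun f hf => ?_⟩
  have h := hM.2 _ (mem_fstSection.1 hf)
  rw [brownianShift_apply, map_zero, smul_zero, add_zero, mul_zero] at h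
  exact h

theorem brownianDefect_mem_fstSection (hM : IsInvariantSubspace (brownianShift σ θ) M)
    (hg : WithLp.toLp 2 (g, 1) ∈ M) :
    brownianDefect σ (Complex.exp (θ * Complex.I)) g ∈ fstSection M := by
  have hsub : WithLp.toLp 2 (brownianDefect σ (Complex.exp (θ * Complex.I)) g, (0 : ℂ))
      = brownianShift σ θ (WithLp.toLp 2 (g, 1))
        - Complex.exp (θ * Complex.I) • WithLp.toLp 2 (g, (1 : ℂ)) := by
    rw [brownianShift_apply, ← map_smul, smul_eq_mul, mul_one]
    exact WithLp.ofLp_injective 2 (Prod.ext rfl (by simp))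
  exact mem_fstSection.2 (hsub ▸ M.sub_mem (hM.2 _ hg) (M.smul_mem _ hg))

theorem exists_eq_typeISubspace (hM : IsInvariantSubspace (brownianShift σ θ) M) (hne : M ≠ ⊥)
    (h₀ : ∀ x ∈ M, x.snd = 0) : ∃ φ : ℂ → ℂ, IsScalarInner φ ∧ M = typeISubspace φ := by
  have hM' := hilbertProd_fstSection_bot h₀
  have hne' : fstSection M ≠ ⊥ := fun h => hne <| by
    rw [← hM', h, hilbertProd, Submodule.prod_bot]
    exact LinearMap.ker_eq_bot.2 (WithLp.linearEquiv 2 ℂ _).injective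
  obtain ⟨φ, hφ, hN⟩ :=
    exists_eq_mulHardy (isInvariantSubspace_fstSection_brownianShift hM) hne'
  exact ⟨φ, hφ, by rw [typeISubspace, ← hN, hM']⟩

theorem exists_eq_typeIISubspace (hσ : σ ≠ 0) (hM : IsInvariantSubspace (brownianShift σ θ) M)
    (hg : WithLp.toLp 2 (g, 1) ∈ M) (horth : g ∈ (fstSection M)ᗮ) :
    ∃ φ : ℂ → ℂ, IsScalarInner φ ∧ IsTypeIIPair σ θ φ g ∧ M = typeIISubspace φ g := by
  set w := Complex.exp (θ * Complex.I)
  have hq : brownianDefect σ w g ∈ fstSection M := brownianDefect_mem_fstSection hM hg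
  have hqn : ‖brownianDefect σ w g‖ = ‖(σ : ℂ)‖ :=
    norm_brownianDefect (Complex.norm_exp_ofReal_mul_I θ)
      ((Submodule.mem_orthogonal' _ _).1 horth _ hq)
  have hne : fstSection M ≠ ⊥ := fun h => by
    rw [h, Submodule.mem_bot] at hq
    rw [hq, norm_zero] at hqn
    exact hσ (Complex.ofReal_eq_zero.1 (norm_eq_zero.1 hqn.symm))
  obtain ⟨φ, hφ, hN⟩ :=
    exists_eq_mulHardy (isInvariantSubspace_fstSection_brownianShift hM) hne
  rw [hN] at hq horth
  obtain ⟨b, hb⟩ := exists_brownianDefect_eq_mulIsometry hφ horth hq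
  rw [hb, LinearIsometry.norm_map, lp.norm_single two_pos] at hqn
  refine ⟨φ, hφ, isTypeIIPair_of_eq_mul hσ hqn fun z hz => ?_, ?_⟩
  · rw [← hardyEval_brownianDefect hz, hb, hφ.hardyEval_mulIsometry _ hz, hardyEval_single,
      pow_zero, one_smul, mul_comm]
  · rw [typeIISubspace, typeISubspace, ← hN, span_sup_hilbertProd_fstSection_bot hg]

theorem typeI_or_typeII_of_isInvariantSubspace (hσ : σ ≠ 0)
    (hM : IsInvariantSubspace (brownianShift σ θ) M) (hne : M ≠ ⊥) :
    (∃ φ : ℂ → ℂ, IsScalarInner φ ∧ M = typeISubspace φ) ∨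
      ∃ (φ : ℂ → ℂ) (g : Hardy ℂ),
        IsScalarInner φ ∧ IsTypeIIPair σ θ φ g ∧ M = typeIISubspace φ g := by
  by_cases h₀ : ∀ x ∈ M, x.snd = 0
  · exact .inl (exists_eq_typeISubspace hM hne h₀)
  · push Not at h₀
    obtain ⟨x, hx, hx₀⟩ := h₀
    obtain ⟨g, horth, hg⟩ := exists_mem_orthogonal_fstSection hM.1 hx hx₀
    obtain ⟨φ, h⟩ := exists_eq_typeIISubspace hσ hM hg horth
    exact .inr ⟨φ, g, h⟩

end InvariantSubspaces

end Brownian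

section ThreeBrownian

variable {σ θ : ℝ} {M₀ : Submodule ℂ HardyBidisc} {M₁ : Submodule ℂ BrownianSpace}

theorem isInvariantSubspace_fstSection_threeBrownianShift {M : Submodule ℂ ThreeBrownianSpace}
    (hM : IsInvariantSubspace (threeBrownianShift σ θ) M) :
    IsInvariantSubspace mulZ₁ (fstSection M) := by
  refine ⟨isClosed_fstSection hM.1, fun F hF => ?_⟩
  have hF' : WithLp.toLp 2 (F, WithLp.toLp 2 ((0 : Hardy ℂ), (0 : ℂ))) ∈ M := hF
  have h := hM.2 _ hF'
  rw [threeBrownianShift_apply, map_zero, map_zero, map_zero, smul_zero, smul_zero, add_zero,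
    add_zero, mul_zero] at h
  exact h

theorem embedJ_mem_of_mem (hσ : σ ≠ 0)
    (hM : IsInvariantSubspace (threeBrownianShift σ θ) (hilbertProd M₀ M₁)) {f : Hardy ℂ} {α : ℂ}
    (hf : WithLp.toLp 2 (f, α) ∈ M₁) : embedJ f ∈ M₀ := by
  have hmem : WithLp.toLp 2 (0, WithLp.toLp 2 (f, α)) ∈ hilbertProd M₀ M₁ := ⟨M₀.zero_mem, hf⟩
  have h := hM.2 _ hmem
  rw [threeBrownianShift_apply, map_zero, zero_add] at h
  exact (M₀.smul_mem_iff (Complex.ofReal_ne_zero.2 hσ)).1 h.1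

theorem exists_eq_mulBidisc_sup_mulVector (hσ : σ ≠ 0) {φ : ℂ → ℂ} (hφ : IsScalarInner φ)
    (hM : IsInvariantSubspace (threeBrownianShift σ θ) (hilbertProd M₀ (typeISubspace φ))) :
    ∃ (E : Type) (_ : NormedAddCommGroup E) (_ : InnerProductSpace ℂ E) (_ : CompleteSpace E)
      (Ψ : ℂ → E →L[ℂ] modelSpace φ), IsInnerFunction Ψ ∧ mulBidisc φ ⟂ mulVector Ψ ∧
      M₀ = mulBidisc φ ⊔ mulVector Ψ := by
  have hM₀ := isInvariantSubspace_fstSection_threeBrownianShift hM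
  rw [fstSection_hilbertProd] at hM₀
  obtain ⟨E, hE₁, hE₂, hE₃, Ψ, hΨ, horth, hsup, -⟩ :=
    exists_eq_map_hardySubspace_sup_mulVector hφ.isClosed_mulHardy (le_refl (modelSpace φ)) hM₀
      fun _ hf => embedJ_mem_of_mem hσ hM (mem_fstSection.1 ((fstSection_hilbertProd _ _).ge hf))
  rw [← hφ.mulBidisc_eq] at horth hsup
  exact ⟨E, hE₁, hE₂, hE₃, Ψ, hΨ, horth, hsup⟩

theorem exists_eq_mulBidisc_sup_mulHardyZ₁_sup_mulVector (hσ : σ ≠ 0) {φ : ℂ → ℂ}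
    {g : Hardy ℂ} (hφ : IsScalarInner φ) (hg : g ∈ modelSpace φ)
    (hM : IsInvariantSubspace (threeBrownianShift σ θ) (hilbertProd M₀ (typeIISubspace φ g))) :
    ∃ (E : Type) (_ : NormedAddCommGroup E) (_ : InnerProductSpace ℂ E) (_ : CompleteSpace E)
      (Ψ : ℂ → E →L[ℂ] modelSpace φ), IsInnerFunction Ψ ∧ mulBidisc φ ⟂ mulHardyZ₁ g ∧
      mulBidisc φ ⟂ mulVector Ψ ∧ mulHardyZ₁ g ⟂ mulVector Ψ ∧
      M₀ = mulBidisc φ ⊔ mulHardyZ₁ g ⊔ mulVector Ψ ∧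
      ∀ e, inner ℂ g (Ψ 0 e : Hardy ℂ) = 0 := by
  have hM₀ := isInvariantSubspace_fstSection_threeBrownianShift hM
  rw [fstSection_hilbertProd] at hM₀
  have hφg : mulHardy φ ⟂ ℂ ∙ g :=
    (Submodule.isOrtho_iff_le.2 ((Submodule.span_singleton_le_iff_mem _ _).2 hg)).symm
  have hclosed : IsClosed ((mulHardy φ ⊔ ℂ ∙ g : Submodule ℂ (Hardy ℂ)) : Set (Hardy ℂ)) :=
    Submodule.isClosed_sup_finiteDimensional _ _ hφ.isClosed_mulHardy
  have hmem : mulHardy φ ⊔ ℂ ∙ g ≤ M₀.comap embedJ.toLinearMap :=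
    sup_le (fun _ hf => embedJ_mem_of_mem hσ hM (Submodule.mem_sup_right ⟨hf, rfl⟩)) <|
      (Submodule.span_singleton_le_iff_mem _ _).2 <|
        embedJ_mem_of_mem hσ hM (Submodule.mem_sup_left (Submodule.mem_span_singleton_self _))
  obtain ⟨E, hE₁, hE₂, hE₃, Ψ, hΨ, horth, hsup, h₀⟩ :=
    exists_eq_map_hardySubspace_sup_mulVector hclosed
      (Submodule.orthogonal_le le_sup_left : _ ≤ modelSpace φ) hM₀ fun _ hf => hmem hf
  rw [hardySubspace_sup hφ.isClosed_mulHardy hφg, Submodule.map_sup, ← hφ.mulBidisc_eq,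
    ← mulHardyZ₁_eq] at horth hsup
  refine ⟨E, hE₁, hE₂, hE₃, Ψ, hΨ, ?_, horth.mono_left le_sup_left, horth.mono_left le_sup_right,
    hsup, fun e => h₀ e g (Submodule.mem_sup_right (Submodule.mem_span_singleton_self g))⟩
  rw [hφ.mulBidisc_eq, mulHardyZ₁_eq]
  exact (isOrtho_hardySubspace hφg).map bidiscEquiv.toLinearIsometry

end ThreeBrownian

end

theorem theorem2p1 (σ θ : ℝ) (hσ : 0 < σ) (hθ : θ ∈ Set.Ico 0 (2 * Real.pi))
    (M₀ : Submodule ℂ HardyBidisc) (M₁ : Submodule ℂ BrownianSpace)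
    (hM : IsInvariantSubspace (threeBrownianShift σ θ) (hilbertProd M₀ M₁))
    (hM₁ : IsInvariantSubspace (brownianShift σ θ) M₁) (hne : M₁ ≠ ⊥) :
    ((∃ φ : ℂ → ℂ, IsScalarInner φ ∧ M₁ = typeISubspace φ) ∨
      (∃ (φ : ℂ → ℂ) (g : Hardy ℂ),
        IsScalarInner φ ∧ IsTypeIIPair σ θ φ g ∧ M₁ = typeIISubspace φ g)) ∧
    (∀ φ : ℂ → ℂ, IsScalarInner φ → M₁ = typeISubspace φ →
      ∃ (E : Type) (_ : NormedAddCommGroup E) (_ : InnerProductSpace ℂ E) (_ : CompleteSpace E)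
        (Ψ : ℂ → E →L[ℂ] modelSpace φ),
        IsInnerFunction Ψ ∧
        mulBidisc φ ⟂ mulVector Ψ ∧
        M₀ = mulBidisc φ ⊔ mulVector Ψ) ∧
    (∀ (φ : ℂ → ℂ) (g : Hardy ℂ), IsScalarInner φ → IsTypeIIPair σ θ φ g →
      M₁ = typeIISubspace φ g →
      g ∈ modelSpace φ ∧
      ∃ (E : Type) (_ : NormedAddCommGroup E) (_ : InnerProductSpace ℂ E) (_ : CompleteSpace E)
        (Ψ : ℂ → E →L[ℂ] modelSpace φ),
        IsInnerFunction Ψ ∧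
        mulBidisc φ ⟂ mulHardyZ₁ g ∧
        mulBidisc φ ⟂ mulVector Ψ ∧
        mulHardyZ₁ g ⟂ mulVector Ψ ∧
        M₀ = mulBidisc φ ⊔ mulHardyZ₁ g ⊔ mulVector Ψ ∧
        ∀ e : E, inner ℂ g (Ψ 0 e : Hardy ℂ) = 0) := by
  refine ⟨typeI_or_typeII_of_isInvariantSubspace hσ.ne' hM₁ hne, fun φ hφ h => ?_,
    fun φ g hφ hg h => ?_⟩ <;> subst h
  · exact exists_eq_mulBidisc_sup_mulVector hσ.ne' hφ hM
  · have hgφ := hg.mem_modelSpace hφ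
    exact ⟨hgφ, exists_eq_mulBidisc_sup_mulHardyZ₁_sup_mulVector hσ.ne' hφ hgφ hM⟩
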